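/- Let $f>0$, $\kappa>0$ and $r\ge 0$. **The problem.** A feasible layout is a sequence of distinct facilities $x_0,x_1,x_2,\dots$ in the Euclidean plane $\mathbb R^2$ whose Voronoi cells $\mathcal A_i=\{p:\|p-x_i\|\le\|p-x_j\|\ \forall j\}$ (the service regions) cover the plane and are bounded with nonempty interior. For $N$ distinct facilities, visited by the truck in the order $y_1,\dots,y_N$ (after coming from a facility $y_0$ and before going on to a facility $y_{N+1}$; $y_0=y_N$ and $y_{N+1}=y_1$ for a closed tour), with service regions $S_1,\dots,S_N$ of areas $|S_i|$, the average cost is $$z_N=\frac{f}{\sum_{i=1}^N|S_i|}\sum_{i=1}^N\Big(1+\kappa\int_{S_i}\|p-y_i\|\,dp\Big)+\frac{\kappa r f}{N}\sum_{i=1}^N l_i,\qquad l_i=\tfrac12\big(\|y_i-y_{i-1}\|+\|y_i-y_{i+1}\|\big).$$ The optimal cost $z$ is the infimum of $\liminf_{N\to\infty}z_N$ over all feasible layouts and all choices, for every $N$, of a tour through $N$ of the facilities, each served facility having its Voronoi cell as service region. **The constants.** For an integer $n\ge3$ and $0\le\alpha<\pi/2$ put $\bar\alpha=\frac{\pi-2\alpha}{n-2}$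 and $$H(n,r,\alpha)=\sin\alpha\cos^2\bar\alpha\,\log\tan\Big(\frac\pi4+\frac{\bar\alpha}2\Big)-\cos^2\alpha\sin\bar\alpha\,\log\tan\Big(\frac\pi4+\frac\alpha2\Big)-r\sin2\alpha\sin\bar\alpha-r(n-2)\cos\bar\alpha\sin^2\bar\alpha .$$ Then $H(n,r,\cdot)$ has exactly one root $\alpha^*(n,r)$ in $[\frac\pi n,\frac\pi2)$; with $\alpha=\alpha^*(n,r)$ and the corresponding $\bar\alpha$ put $$g(n,r)=\frac{3\sin\bar\alpha\,\big(\sin2\alpha+(n-2)\cos\bar\alpha\sin\bar\alpha\big)^{1/2}}{\sin\bar\alpha+\cos^2\bar\alpha\,\log\tan\big(\frac\pi4+\frac{\bar\alpha}2\big)+4r\sin\bar\alpha\cos\alpha}.$$ The limit $\lim_{n\to\infty}(n-2)H(n,r,\alpha)$ exists for every $\alpha\in[0,\frac\pi2)$ and, as a function of $\alpha$, has exactly one root $\alpha^*(\infty,r)$ in $[0,\frac\pi2)$; the limit $g(\infty,r)=\lim_{n\to\infty}g(n,r)$ exists and is positive. **Lower bound.** $$z\ \ge\ 3\sqrt[3]{\frac{\kappa^2f^3}{4g^2(\infty,r)}}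 .$$ **Attainment by an idealized arrangement.** Put $\alpha=\alpha^*(\infty,r)$. There is $R>0$ such that the following holds for the facilities $y_k=(2Rk\cos\alpha,0)$, $k=0,1,2,\dots$, where the region $S_k$ of $y_k$ is the union of two isosceles triangles with apex $y_k$, apex angle $2\alpha$ and legs $R$, lying in the directions $\pm(1,0)$ (degenerate if $\alpha=0$), and the two circular sectors centred at $y_k$, of radius $R$ and angle $\pi-2\alpha$, that fill the gaps between the triangles. Every $S_k$ has area $(\kappa/2)^{-2/3}g(\infty,r)^{2/3}$; the $S_k$ overlap only in null sets; each point of $S_k$ has $y_k$ as a nearest facility; and for every $N\ge1$ the average cost $z_N$ of $y_1,\dots,y_N$ with regions $S_1,\dots,S_N$ (and $y_0$, $y_{N+1}$ as neighbours at the ends) is exactly $3\sqrt[3]{\kappa^2f^3/(4g^2(\infty,r))}$. This arrangement is infeasible: the $S_k$ do not cover the plane, and no service region of a feasible layout is congruent to $S_k$. -/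

import Mathlib

open Real Set Filter Topology MeasureTheory

noncomputable section

namespace Transship

/-- The Euclidean plane. -/
abbrev Plane : Type := EuclideanSpace ℝ (Fin 2)

/-! ### The location-routing problem -/

/-- The service region of facility `i`: the points for which `i` is a nearest facility. -/
def voronoiCell (x : ℕ → Plane) (i : ℕ) : Set Plane :=
  {p | ∀ j, dist p (x i) ≤ dist p (x j)}

/-- A feasible layout of the infinitely many facilities in the plane: the facilities are distinct,
the service regions cover the plane, and each of them is bounded with nonempty interior
(as every nondegenerate convex polygon is), so that its area and its outbound cost make sense. -/
structure IsFeasibleLayout (x : ℕ → Plane) : Prop where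
  injective : Function.Injective x
  cover : (⋃ i, voronoiCell x i) = univ
  bounded : ∀ i, Bornology.IsBounded (voronoiCell x i)
  nondegenerate : ∀ i, (interior (voronoiCell x i)).Nonempty

/-- The area of a region. -/
def area (S : Set Plane) : ℝ := (volume S).toReal

/-- The outbound travel `∫_S ‖p - c‖ dp` of a region `S` served from `c`. -/
def outbound (S : Set Plane) (c : Plane) : ℝ := ∫ p in S, dist p c

/-- The inbound distance `l_i` travelled in the region of the `i`-th facility of the tour `x`. -/
def inboundLength (x : ℕ → Plane) (i : ℕ) : ℝ :=
  (dist (x i) (x (i - 1)) + dist (x i) (x (i + 1))) / 2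

/-- The cost per unit area-time of the facilities `x 1, …, x N`, visited in this order, with service
regions `S 1, …, S N`. The points `x 0` and `x (N + 1)` are those from which the truck enters
`x 1` and for which it leaves `x N`. -/
def averageCost (f κ r : ℝ) (N : ℕ) (x : ℕ → Plane) (S : ℕ → Set Plane) : ℝ :=
  f / (∑ i ∈ Finset.Icc 1 N, area (S i)) *
      (∑ i ∈ Finset.Icc 1 N, (1 + κ * outbound (S i) (x i)))
    + κ * r * f / N * ∑ i ∈ Finset.Icc 1 N, inboundLength x i

/-- `t` describes a truck tour through `N` distinct facilities `t 1, …, t N` of a layout. The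
predecessor `t 0` of the first and the successor `t (N + 1)` of the last are not restricted;
a closed tour has `t 0 = t N` and `t (N + 1) = t 1`. -/
def IsTour (N : ℕ) (t : ℕ → ℕ) : Prop := InjOn t (Icc 1 N)

/-- The optimal value: the infimum, over all feasible layouts `x` and all choices of a tour `t N`
through `N` of the facilities for every `N`, of the limit inferior of the cost as `N → ∞`. -/
def optimalCost (f κ r : ℝ) : EReal :=
  ⨅ (x : ℕ → Plane) (t : ℕ → ℕ → ℕ) (_ : IsFeasibleLayout x) (_ : ∀ N, IsTour N (t N)),
    liminf (fun N : ℕ =>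
      ((averageCost f κ r N (fun i => x (t N i)) (fun i => voronoiCell x (t N i)) : ℝ) : EReal))
      atTop

/-! ### The functions `H`, `α*` and `g` -/

/-- The half-angle `(π - 2α) / (n - 2)` of the remaining `n - 2` triangles. -/
def alphaBar (n : ℕ) (α : ℝ) : ℝ := (π - 2 * α) / ((n : ℝ) - 2)

/-- The function `H(n, r, α)`. -/
def angleH (n : ℕ) (r α : ℝ) : ℝ :=
  sin α * cos (alphaBar n α) ^ 2 * log (tan (π / 4 + alphaBar n α / 2))
    - cos α ^ 2 * sin (alphaBar n α) * log (tan (π / 4 + α / 2))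
    - r * sin (2 * α) * sin (alphaBar n α)
    - r * ((n : ℝ) - 2) * cos (alphaBar n α) * sin (alphaBar n α) ^ 2

/-- `α*(n, r)`: the root of `H(n, r, ·)` in `[π/n, π/2)`. -/
def alphaStar (n : ℕ) (r : ℝ) : ℝ :=
  sInf {α | α ∈ Ico (π / n) (π / 2) ∧ angleH n r α = 0}

/-- The function `g(n, r)`. -/
def gFun (n : ℕ) (r : ℝ) : ℝ :=
  3 * sin (alphaBar n (alphaStar n r)) *
      √(sin (2 * alphaStar n r) + ((n : ℝ) - 2) * cos (alphaBar n (alphaStar n r)) *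
          sin (alphaBar n (alphaStar n r))) /
    (sin (alphaBar n (alphaStar n r))
      + cos (alphaBar n (alphaStar n r)) ^ 2 *
          log (tan (π / 4 + alphaBar n (alphaStar n r) / 2))
      + 4 * r * sin (alphaBar n (alphaStar n r)) * cos (alphaStar n r))

/-- `lim_{n → ∞} (n - 2) H(n, r, α)`. -/
def angleHInf (r α : ℝ) : ℝ :=
  limUnder atTop (fun n : ℕ => ((n : ℝ) - 2) * angleH n r α)

/-- `α*(∞, r)`: the root of `lim_{n → ∞} (n - 2) H(n, r, ·)` in `[0, π/2)`. -/
def alphaInf (r : ℝ) : ℝ := sInf {α | α ∈ Ico 0 (π / 2) ∧ angleHInf r α = 0}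

/-- `g(∞, r) = lim_{n → ∞} g(n, r)`. -/
def gInf (r : ℝ) : ℝ := limUnder atTop (fun n : ℕ => gFun n r)

/-- The lower bound `3 (κ² f³ / (4 g(∞, r)²))^(1/3)`. -/
def costBound (f κ r : ℝ) : ℝ := 3 * (κ ^ 2 * f ^ 3 / (4 * gInf r ^ 2)) ^ (1 / 3 : ℝ)

/-! ### The idealized straight-line arrangement -/

/-- The unit vector at angle `θ`. -/
def dir (θ : ℝ) : Plane := !₂[cos θ, sin θ]

/-- The closed isosceles triangle with apex `c` whose other two vertices lie at distance `R`
from `c` in the directions `θ₁` and `θ₂`. -/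
def isoTriangle (c : Plane) (R θ₁ θ₂ : ℝ) : Set Plane :=
  convexHull ℝ {c, c + R • dir θ₁, c + R • dir θ₂}

/-- The closed circular sector with centre `c`, radius `R` and directions from `θ₁` to `θ₂`. -/
def circSector (c : Plane) (R θ₁ θ₂ : ℝ) : Set Plane :=
  {p | ∃ ρ ∈ Icc 0 R, ∃ θ ∈ Icc θ₁ θ₂, p = c + ρ • dir θ}

/-- Two triangles with angle `2α` at `c`, facing along the line, and the two circular sectors
with angle `π - 2α` between them. -/
def idealRegion (c : Plane) (R α : ℝ) : Set Plane :=
  isoTriangle c R (-α) α ∪ isoTriangle c R (π - α) (π + α) ∪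
    (circSector c R α (π - α) ∪ circSector c R (π + α) (2 * π - α))

/-- Evenly spaced facilities on a straight line, such that the triangles of consecutive regions
share a side. -/
def lineSite (R α : ℝ) (k : ℕ) : Plane := !₂[2 * R * cos α * k, 0]

end Transship

end

namespace Transship

/-! The lower bound is a duality argument. For any radius `R`, `t ≥ R - (R - t)₊`, so the outbound
travel of a region is at least `R` times its area minus the integral over it of the cone `(R -
dist)₊` at its facility; `R` prices area. The regions are almost disjoint, so these cone integrals
together are at most the integral of the upper envelope of the cones. Following the tour, the
envelope is at most the first cone plus the positive parts of the successive differences. Such a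
positive part integrates to `coneStrip R (d / 2)`, the integral of one cone over a strip as wide as
the distance `d` of the two facilities (`integral_cone_sub`). Thus outbound travel is controlled by
the leg lengths alone (`sum_setIntegral_cone_le`).

Slices of a cone shrink away from the apex, so `coneStrip` is concave in the width and lies below
its tangent at `R cos α` (`coneStrip_le`). The equation of `α*(∞, r)` says exactly that the slope of
this tangent is the price of inbound travel (`coneSlice_alphaInf`). The leg lengths cancel, leaving
`N u³ / g(∞, r)` up to the one initial cone, where `u²` is the mean area (`lower_bound_travel`).
That cone also scales like `u³`, so it only perturbs the coefficient by `O(1/N)`, uniformly in `u`;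
minimising over `u` by the AM-GM inequality gives the bound.

Every inequality except the loss at the ends is an equality for discs of radius `R` truncated at
distance `R cos α` and threaded on a line. The prescribed region is such a disc (`idealRegion_eq`),
which gives the exact cost.

For infeasibility, an exposed point of a Voronoi cell, other than the facility, lies on a bisector,
and no two of them share one. Hence a cell has countably many exposed points, whereas a truncated
disc has arcs full of them.

The constants are treated through `H / sin ᾱ`, which is strictly increasing on the relevant
interval; its pointwise limit then locates the limit of the roots. -/

/-! ### The inverse Gudermannian function -/

/-- The function `log tan (π/4 + x/2)`, a primitive of `1 / cos`. -/
noncomputable def invGd (x : ℝ) : ℝ := log (tan (π / 4 + x / 2))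

/-- With `c`, `s` the cosine and sine of `x / 2`, both arguments of the logarithm are `(c + s) / (c
- s)`, since `1 + sin x = (c + s)²` and `cos x = (c - s)(c + s)`. -/
lemma invGd_eq {x : ℝ} (hx : 0 < cos x) : invGd x = log ((1 + sin x) / cos x) := by
  unfold invGd
  congr 1
  have hs : sin x = 2 * sin (x / 2) * cos (x / 2) := by
    rw [← sin_two_mul]; congr 1; ring
  have hc : cos x = cos (x / 2) ^ 2 - sin (x / 2) ^ 2 := by
    rw [← cos_two_mul']; congr 1; ring
  have h1 := sin_sq_add_cos_sq (x / 2)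
  have hne : cos (x / 2) - sin (x / 2) ≠ 0 := by
    intro h
    have : cos x = (cos (x / 2) - sin (x / 2)) * (cos (x / 2) + sin (x / 2)) := by rw [hc]; ring
    rw [h, zero_mul] at this
    exact hx.ne' this
  have h2 : (√2 / 2 : ℝ) ≠ 0 := by positivity
  rw [tan_eq_sin_div_cos, sin_add, cos_add, sin_pi_div_four, cos_pi_div_four, ← mul_add,
    ← mul_sub, mul_div_mul_left _ _ h2, div_eq_div_iff hne hx.ne', hs, hc]
  linear_combination (cos (x / 2) - sin (x / 2)) * h1

lemma hasDerivAt_invGd {x : ℝ} (hx : 0 < cos x) : HasDerivAt invGd (1 / cos x) x := by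
  have h1 : 0 < 1 + sin x := by
    nlinarith [sin_sq_add_cos_sq x, neg_one_le_sin x, pow_pos hx 2]
  have h := (((hasDerivAt_sin x).const_add 1).div (hasDerivAt_cos x) hx.ne').log
    (div_pos h1 hx).ne'
  have e : invGd =ᶠ[𝓝 x] fun y => log ((1 + sin y) / cos y) := by
    filter_upwards [continuous_cos.continuousAt.eventually (lt_mem_nhds hx)] with y hy
    exact invGd_eq hy
  refine (h.congr_of_eventuallyEq e).congr_deriv ?_
  simp only [Pi.div_apply]
  field_simp
  linear_combination sin_sq_add_cos_sq x

@[simp] lemma invGd_zero : invGd 0 = 0 := by simp [invGd]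

lemma cos_pos_of_mem {x : ℝ} (hx : x ∈ Ico 0 (π / 2)) : 0 < cos x :=
  cos_pos_of_mem_Ioo ⟨by linarith [hx.1, pi_pos], hx.2⟩

lemma self_le_invGd {x : ℝ} (hx : x ∈ Ico 0 (π / 2)) : x ≤ invGd x := by
  have hm : MonotoneOn (fun y => invGd y - y) (Ico 0 (π / 2)) := by
    refine monotoneOn_of_hasDerivWithinAt_nonneg (f' := fun y => 1 / cos y - 1)
      (convex_Ico _ _) ?_ ?_ ?_
    · intro y hy
      exact ((hasDerivAt_invGd (cos_pos_of_mem hy)).sub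
        (hasDerivAt_id y)).continuousAt.continuousWithinAt
    · intro y hy
      rw [interior_Ico] at hy
      exact ((hasDerivAt_invGd (cos_pos_of_mem ⟨hy.1.le, hy.2⟩)).sub
        (hasDerivAt_id y)).hasDerivWithinAt
    · intro y hy
      rw [interior_Ico] at hy
      have := cos_pos_of_mem ⟨hy.1.le, hy.2⟩
      rw [sub_nonneg, le_div_iff₀ this]
      linarith [cos_le_one y]
  have := hm ⟨le_rfl, by positivity⟩ hx hx.1
  simpa using this

lemma invGd_nonneg {x : ℝ} (hx : x ∈ Ico 0 (π / 2)) : 0 ≤ invGd x :=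
  hx.1.trans (self_le_invGd hx)

lemma sin_le_invGd {x : ℝ} (hx : x ∈ Ico 0 (π / 2)) : sin x ≤ invGd x :=
  (sin_le hx.1).trans (self_le_invGd hx)

/-- From `log t ≤ t - 1`. The bound is continuous and vanishes at `π / 2`, which tames the
logarithmic singularity there. -/
lemma cos_sq_mul_invGd_le {x : ℝ} (hx : 0 < cos x) : cos x ^ 2 * invGd x ≤ 2 * cos x := by
  have h1 : 0 < 1 + sin x := by
    nlinarith [sin_sq_add_cos_sq x, neg_one_le_sin x, pow_pos hx 2]
  have h : invGd x ≤ (1 + sin x) / cos x := by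
    rw [invGd_eq hx]
    linarith [log_le_sub_one_of_pos (div_pos h1 hx)]
  calc cos x ^ 2 * invGd x ≤ cos x ^ 2 * ((1 + sin x) / cos x) := by gcongr
    _ = cos x * (1 + sin x) := by field_simp
    _ ≤ 2 * cos x := by nlinarith [sin_le_one x]

/-- The function `cos² x · log tan (π/4 + x/2) / sin x`. -/
noncomputable def gdRatio (x : ℝ) : ℝ := cos x ^ 2 * invGd x / sin x

lemma hasDerivAt_gdRatio {x : ℝ} (hx : x ∈ Ioo 0 (π / 2)) :
    HasDerivAt gdRatio (cos x * (sin x - invGd x * (1 + sin x ^ 2)) / sin x ^ 2) x := by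
  have hc : 0 < cos x := cos_pos_of_mem ⟨hx.1.le, hx.2⟩
  have hs : 0 < sin x := sin_pos_of_pos_of_lt_pi hx.1 (by linarith [hx.2, pi_pos])
  have h := (((hasDerivAt_cos x).pow 2).mul (hasDerivAt_invGd hc)).div (hasDerivAt_sin x) hs.ne'
  refine h.congr_deriv ?_
  simp only [Pi.mul_apply, Pi.pow_apply]
  field_simp
  simp only [Nat.cast_ofNat]
  linear_combination (-cos x * invGd x) * sin_sq_add_cos_sq x

/-- The sign of the derivative comes from `sin x ≤ invGd x`. Used to compare the values at `ᾱ ≤ α`.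
-/
lemma gdRatio_antitoneOn : AntitoneOn gdRatio (Ioo 0 (π / 2)) := by
  refine antitoneOn_of_hasDerivWithinAt_nonpos
    (f' := fun x => cos x * (sin x - invGd x * (1 + sin x ^ 2)) / sin x ^ 2)
    (convex_Ioo _ _) ?_ ?_ ?_
  · intro x hx
    exact (hasDerivAt_gdRatio hx).continuousAt.continuousWithinAt
  · intro x hx
    rw [interior_Ioo] at hx
    exact (hasDerivAt_gdRatio hx).hasDerivWithinAt
  · intro x hx
    rw [interior_Ioo] at hx
    have hx' : x ∈ Ico 0 (π / 2) := ⟨hx.1.le, hx.2⟩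
    have hc := cos_pos_of_mem hx'
    have h1 := sin_le_invGd hx'
    have h2 := invGd_nonneg hx'
    apply div_nonpos_of_nonpos_of_nonneg _ (sq_nonneg _)
    apply mul_nonpos_of_nonneg_of_nonpos hc.le
    nlinarith [mul_nonneg h2 (sq_nonneg (sin x))]

lemma cos_sq_le_gdRatio {x : ℝ} (hx : x ∈ Ioo 0 (π / 2)) : cos x ^ 2 ≤ gdRatio x := by
  have hs : 0 < sin x := sin_pos_of_pos_of_lt_pi hx.1 (by linarith [hx.2, pi_pos])
  rw [gdRatio, le_div_iff₀ hs]
  exact mul_le_mul_of_nonneg_left (sin_le_invGd ⟨hx.1.le, hx.2⟩) (sq_nonneg _)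

lemma tendsto_gdRatio : Tendsto gdRatio (𝓝[>] 0) (𝓝 1) := by
  have h1 : Tendsto (fun x : ℝ => x⁻¹ * invGd x) (𝓝[>] 0) (𝓝 1) := by
    have h := (hasDerivAt_invGd (x := 0) (by simp)).tendsto_slope_zero_right
    simpa using h
  have h2 : Tendsto (fun x : ℝ => x⁻¹ * sin x) (𝓝[>] 0) (𝓝 1) := by
    have h := (hasDerivAt_sin 0).tendsto_slope_zero_right
    simpa using h
  have h3 : Tendsto (fun x : ℝ => cos x ^ 2) (𝓝[>] 0) (𝓝 1) := by
    have h : Tendsto (fun x : ℝ => cos x ^ 2) (𝓝 0) (𝓝 (cos 0 ^ 2)) :=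
      (continuous_cos.pow 2).tendsto 0
    rw [cos_zero, one_pow] at h
    exact h.mono_left nhdsWithin_le_nhds
  have h4 := (h3.mul h1).div h2 one_ne_zero
  rw [one_mul, div_one] at h4
  refine h4.congr' ?_
  filter_upwards [self_mem_nhdsWithin] with x hx
  have hx' : x ≠ 0 := (mem_Ioi.1 hx).ne'
  simp only [Pi.div_apply, gdRatio]
  rw [← mul_assoc, mul_comm _ x⁻¹, mul_assoc, mul_div_mul_left _ _ (inv_ne_zero hx')]

/-! ### The root of `H(n, r, ·)` -/

/-- The quotient `H(n, r, α) / sin ᾱ`. -/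
noncomputable def reducedH (n : ℕ) (r α : ℝ) : ℝ :=
  sin α * gdRatio (alphaBar n α) - cos α ^ 2 * invGd α
    - r * (sin (2 * α) + ((n : ℝ) - 2) * cos (alphaBar n α) * sin (alphaBar n α))

lemma alphaBar_mem {n : ℕ} (hn : 3 ≤ n) {α : ℝ} (hα : α ∈ Ico (π / n) (π / 2)) :
    alphaBar n α ∈ Ioc 0 α := by
  have hn' : (3 : ℝ) ≤ n := by exact_mod_cast hn
  have h1 : π ≤ α * n := (div_le_iff₀ (by linarith)).1 hα.1
  refine ⟨div_pos (by linarith [hα.2]) (by linarith), ?_⟩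
  rw [alphaBar, div_le_iff₀ (by linarith)]
  linarith

lemma pos_of_mem {n : ℕ} (hn : 3 ≤ n) {α : ℝ} (hα : α ∈ Ico (π / n) (π / 2)) : 0 < α :=
  (alphaBar_mem hn hα).1.trans_le (alphaBar_mem hn hα).2

lemma alphaBar_mem_Ioo {n : ℕ} (hn : 3 ≤ n) {α : ℝ} (hα : α ∈ Ico (π / n) (π / 2)) :
    alphaBar n α ∈ Ioo 0 (π / 2) :=
  ⟨(alphaBar_mem hn hα).1, (alphaBar_mem hn hα).2.trans_lt hα.2⟩

lemma sin_pos_of_mem {x : ℝ} (hx : x ∈ Ioo 0 (π / 2)) : 0 < sin x :=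
  sin_pos_of_pos_of_lt_pi hx.1 (by linarith [hx.2, pi_pos])

lemma angleH_eq {n : ℕ} {r α : ℝ} (h : sin (alphaBar n α) ≠ 0) :
    angleH n r α = sin (alphaBar n α) * reducedH n r α := by
  unfold angleH reducedH gdRatio invGd
  field_simp
  ring

lemma hasDerivAt_alphaBar (n : ℕ) (α : ℝ) :
    HasDerivAt (alphaBar n) (-2 / ((n : ℝ) - 2)) α := by
  have h := (((hasDerivAt_id α).const_mul 2).const_sub π).div_const ((n : ℝ) - 2)
  refine h.congr_deriv ?_
  simp

/-- Three contributions have a sign. As `α` grows, `ᾱ` falls and `gdRatio ᾱ` rises (`t1`). In the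
rest of the part free of `r`, `gdRatio ᾱ` may be replaced by the smaller `gdRatio α`, leaving a
positive expression in `α` alone (`t2`). The factor of `-r` has derivative `2 cos 2α - 2 cos 2ᾱ ≤ 0`
because `ᾱ ≤ α` (`t3`). -/
lemma exists_hasDerivAt_reducedH {n : ℕ} (hn : 3 ≤ n) {r : ℝ} (hr : 0 ≤ r) {α : ℝ}
    (hα : α ∈ Ico (π / n) (π / 2)) : ∃ D, 0 < D ∧ HasDerivAt (reducedH n r) D α := by
  have hn' : (3 : ℝ) ≤ n := by exact_mod_cast hn
  have hn2 : (n : ℝ) - 2 ≠ 0 := by linarith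
  have hb := alphaBar_mem hn hα
  have hb' := alphaBar_mem_Ioo hn hα
  have hα0 : α ∈ Ioo 0 (π / 2) := ⟨pos_of_mem hn hα, hα.2⟩
  have hα0' : α ∈ Ico 0 (π / 2) := ⟨hα0.1.le, hα.2⟩
  have hc := cos_pos_of_mem hα0'
  have hs := sin_pos_of_mem hα0
  have hab := hasDerivAt_alphaBar n α
  have hP := (hasDerivAt_gdRatio hb').comp α hab
  have hcb := (hasDerivAt_cos (alphaBar n α)).comp α hab
  have hsb := (hasDerivAt_sin (alphaBar n α)).comp α hab
  have h2 := (hasDerivAt_sin (2 * α)).comp α ((hasDerivAt_id α).const_mul 2)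
  have h := (((hasDerivAt_sin α).mul hP).sub
    (((hasDerivAt_cos α).pow 2).mul (hasDerivAt_invGd hc))).sub
      ((h2.add ((hcb.const_mul ((n : ℝ) - 2)).mul hsb)).const_mul r)
  refine ⟨_, ?_, h⟩
  simp only [Function.comp_apply, Pi.pow_apply, Nat.cast_ofNat, mul_one]
  set b := alphaBar n α with hbdef
  have hPb : gdRatio α ≤ gdRatio b := gdRatio_antitoneOn hb' hα0 hb.2
  have hcosb := cos_pos_of_mem ⟨hb'.1.le, hb'.2⟩
  have hsinb := sin_pos_of_mem hb'
  have hgb := sin_le_invGd ⟨hb'.1.le, hb'.2⟩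
  have hg := self_le_invGd hα0'
  have t1 : 0 ≤ sin α * (cos b * (sin b - invGd b * (1 + sin b ^ 2)) / sin b ^ 2 *
      (-2 / ((n : ℝ) - 2))) := by
    apply mul_nonneg hs.le
    apply mul_nonneg_of_nonpos_of_nonpos
    · apply div_nonpos_of_nonpos_of_nonneg _ (sq_nonneg _)
      apply mul_nonpos_of_nonneg_of_nonpos hcosb.le
      nlinarith [mul_nonneg (hsinb.le.trans hgb) (sq_nonneg (sin b))]
    · apply div_nonpos_of_nonpos_of_nonneg <;> linarith
  have t2 : 0 < cos α * gdRatio b - (2 * cos α * -sin α * invGd α + cos α ^ 2 * (1 / cos α)) := by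
    have e : cos α * gdRatio α - (2 * cos α * -sin α * invGd α + cos α ^ 2 * (1 / cos α))
        = cos α * (invGd α * (1 + sin α ^ 2) - sin α) / sin α := by
      unfold gdRatio
      field_simp
      linear_combination invGd α * sin_sq_add_cos_sq α
    have : 0 < cos α * (invGd α * (1 + sin α ^ 2) - sin α) / sin α := by
      apply div_pos (mul_pos hc _) hs
      have := sin_lt hα0.1
      nlinarith [mul_nonneg (hα0.1.le.trans hg) (sq_nonneg (sin α))]
    nlinarith [mul_le_mul_of_nonneg_left hPb hc.le]
  have t3 : cos (2 * α) * 2 + (((n : ℝ) - 2) * (-sin b * (-2 / ((n : ℝ) - 2))) * sin b +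
      ((n : ℝ) - 2) * cos b * (cos b * (-2 / ((n : ℝ) - 2)))) ≤ 0 := by
    have e : ((n : ℝ) - 2) * (-sin b * (-2 / ((n : ℝ) - 2))) * sin b +
      ((n : ℝ) - 2) * cos b * (cos b * (-2 / ((n : ℝ) - 2))) = -2 * cos (2 * b) := by
      rw [cos_two_mul']
      field_simp
      ring
    rw [e]
    have : cos (2 * α) ≤ cos (2 * b) :=
      cos_le_cos_of_nonneg_of_le_pi (by linarith [hb.1]) (by linarith [hα.2]) (by linarith [hb.2])
    linarith
  have t4 := mul_nonpos_of_nonneg_of_nonpos hr t3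
  simp only [Nat.reduceSub, pow_one]
  linarith

lemma strictMonoOn_reducedH {n : ℕ} (hn : 3 ≤ n) {r : ℝ} (hr : 0 ≤ r) :
    StrictMonoOn (reducedH n r) (Ico (π / n) (π / 2)) := by
  refine strictMonoOn_of_deriv_pos (convex_Ico _ _) ?_ ?_
  · intro α hα
    obtain ⟨D, -, hD⟩ := exists_hasDerivAt_reducedH hn hr hα
    exact hD.continuousAt.continuousWithinAt
  · intro α hα
    obtain ⟨D, hD0, hD⟩ := exists_hasDerivAt_reducedH hn hr (interior_subset hα)
    rwa [hD.deriv]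

lemma exists_reducedH_pos {n : ℕ} (hn : 3 ≤ n) (r : ℝ) :
    ∃ α ∈ Ico (π / n) (π / 2), 0 < reducedH n r α := by
  have hn' : (3 : ℝ) ≤ n := by exact_mod_cast hn
  have hlt : π / n < π / 2 := div_lt_div_of_pos_left pi_pos (by norm_num) (by linarith)
  have hcont : Continuous (alphaBar n) := by unfold alphaBar; fun_prop
  -- A continuous minorant of `reducedH`, obtained from `cos_sq_le_gdRatio` and
  -- `cos_sq_mul_invGd_le`, with value 1 at `π / 2`.
  have hlim : Tendsto (fun α => sin α * cos (alphaBar n α) ^ 2 - 2 * cos α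
      - r * (sin (2 * α) + ((n : ℝ) - 2) * cos (alphaBar n α) * sin (alphaBar n α)))
      (𝓝[<] (π / 2)) (𝓝 1) := by
    have hc : Continuous (fun α => sin α * cos (alphaBar n α) ^ 2 - 2 * cos α
      - r * (sin (2 * α) + ((n : ℝ) - 2) * cos (alphaBar n α) * sin (alphaBar n α))) := by
      fun_prop
    have h := hc.tendsto (π / 2)
    have e : alphaBar n (π / 2) = 0 := by
      unfold alphaBar; rw [mul_div_cancel₀ _ two_ne_zero, sub_self, zero_div]
    have e2 : sin (2 * (π / 2)) = 0 := by rw [mul_div_cancel₀ _ two_ne_zero, sin_pi]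
    simp only [e, e2, sin_pi_div_two, cos_pi_div_two, cos_zero, sin_zero] at h
    norm_num at h
    exact h.mono_left nhdsWithin_le_nhds
  have hev := (hlim.eventually (lt_mem_nhds one_pos)).and
    (Ico_mem_nhdsLT hlt : Ico (π / n) (π / 2) ∈ 𝓝[<] (π / 2))
  obtain ⟨α, hα, hm⟩ := hev.exists
  refine ⟨α, hm, hα.trans_le ?_⟩
  have hα0 : α ∈ Ioo 0 (π / 2) := ⟨pos_of_mem hn hm, hm.2⟩
  have h1 := mul_le_mul_of_nonneg_left (cos_sq_le_gdRatio (alphaBar_mem_Ioo hn hm))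
    (sin_pos_of_mem hα0).le
  have h2 := cos_sq_mul_invGd_le (cos_pos_of_mem ⟨hα0.1.le, hα0.2⟩)
  unfold reducedH
  linarith

/-- At `α = π / n` also `ᾱ = π / n`, so the two logarithmic terms cancel and only the term with `-r`
is left. -/
lemma reducedH_left_nonpos {n : ℕ} (hn : 3 ≤ n) {r : ℝ} (hr : 0 ≤ r) :
    reducedH n r (π / n) ≤ 0 := by
  have hn' : (3 : ℝ) ≤ n := by exact_mod_cast hn
  have hlt : π / n < π / 2 := div_lt_div_of_pos_left pi_pos (by norm_num) (by linarith)
  have hm : π / n ∈ Ico (π / n) (π / 2) := ⟨le_rfl, hlt⟩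
  have hα0 : π / n ∈ Ioo 0 (π / 2) := ⟨pos_of_mem hn hm, hlt⟩
  have e : alphaBar n (π / n) = π / n := by
    have h2 : (n : ℝ) - 2 ≠ 0 := by linarith
    have h0 : (n : ℝ) ≠ 0 := by linarith
    unfold alphaBar; field_simp
  have hs := sin_pos_of_mem hα0
  have hc := cos_pos_of_mem ⟨hα0.1.le, hα0.2⟩
  unfold reducedH
  rw [e, gdRatio, mul_div_cancel₀ _ hs.ne', sub_self, zero_sub, neg_nonpos, sin_two_mul]
  have : 0 ≤ (n : ℝ) - 2 := by linarith
  positivity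

lemma existsUnique_angleH_root {n : ℕ} (hn : 3 ≤ n) {r : ℝ} (hr : 0 ≤ r) :
    ∃! α : ℝ, α ∈ Ico (π / n) (π / 2) ∧ angleH n r α = 0 := by
  have key : ∀ α ∈ Ico (π / n) (π / 2), angleH n r α = 0 ↔ reducedH n r α = 0 := fun α hα => by
    have hs := (sin_pos_of_mem (alphaBar_mem_Ioo hn hα)).ne'
    rw [angleH_eq hs, mul_eq_zero, or_iff_right hs]
  obtain ⟨β, hβ, hpos⟩ := exists_reducedH_pos hn r
  have hcont : ContinuousOn (reducedH n r) (Icc (π / n) β) := by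
    intro α hα
    obtain ⟨D, -, hD⟩ := exists_hasDerivAt_reducedH hn hr ⟨hα.1, hα.2.trans_lt hβ.2⟩
    exact hD.continuousAt.continuousWithinAt
  obtain ⟨α, hα, h0⟩ := intermediate_value_Icc hβ.1 hcont ⟨reducedH_left_nonpos hn hr, hpos.le⟩
  have hα' : α ∈ Ico (π / n) (π / 2) := ⟨hα.1, hα.2.trans_lt hβ.2⟩
  refine ⟨α, ⟨hα', (key α hα').2 h0⟩, ?_⟩
  rintro γ ⟨hγ, hγ0⟩
  exact (strictMonoOn_reducedH hn hr).injOn hγ hα' (((key γ hγ).1 hγ0).trans h0.symm)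

lemma alphaStar_spec {n : ℕ} (hn : 3 ≤ n) {r : ℝ} (hr : 0 ≤ r) :
    alphaStar n r ∈ Ico (π / n) (π / 2) ∧ angleH n r (alphaStar n r) = 0 := by
  obtain ⟨α, hα, hu⟩ := existsUnique_angleH_root hn hr
  have : {α | α ∈ Ico (π / n) (π / 2) ∧ angleH n r α = 0} = {α} :=
    eq_singleton_iff_unique_mem.2 ⟨hα, hu⟩
  rw [alphaStar, this, csInf_singleton]
  exact hα

/-- The root lies to the left of every point where `H(n, r, ·)` is positive. -/
lemma alphaStar_lt {n : ℕ} (hn : 3 ≤ n) {r : ℝ} (hr : 0 ≤ r) {α : ℝ}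
    (hα : α ∈ Ico (π / n) (π / 2)) (h : 0 < angleH n r α) : alphaStar n r < α := by
  obtain ⟨hm, h0⟩ := alphaStar_spec hn hr
  have hs := sin_pos_of_mem (alphaBar_mem_Ioo hn hα)
  have hs' := sin_pos_of_mem (alphaBar_mem_Ioo hn hm)
  rw [angleH_eq hs.ne'] at h
  rw [angleH_eq hs'.ne', mul_eq_zero, or_iff_right hs'.ne'] at h0
  by_contra hle
  have := (strictMonoOn_reducedH hn hr).monotoneOn hα hm (not_lt.1 hle)
  linarith [pos_of_mul_pos_right h hs.le]

lemma lt_alphaStar {n : ℕ} (hn : 3 ≤ n) {r : ℝ} (hr : 0 ≤ r) {α : ℝ}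
    (hα : α ∈ Ico (π / n) (π / 2)) (h : angleH n r α < 0) : α < alphaStar n r := by
  obtain ⟨hm, h0⟩ := alphaStar_spec hn hr
  have hs := sin_pos_of_mem (alphaBar_mem_Ioo hn hα)
  have hs' := sin_pos_of_mem (alphaBar_mem_Ioo hn hm)
  rw [angleH_eq hs.ne'] at h
  rw [angleH_eq hs'.ne', mul_eq_zero, or_iff_right hs'.ne'] at h0
  by_contra hle
  have := (strictMonoOn_reducedH hn hr).monotoneOn hm hα (not_lt.1 hle)
  have := mul_nonneg hs.le (h0 ▸ this)
  linarith

/-! ### The limit `n → ∞` -/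

lemma tendsto_natCast_sub_two : Tendsto (fun n : ℕ => (n : ℝ) - 2) atTop atTop :=
  tendsto_atTop_add_const_right _ _ tendsto_natCast_atTop_atTop

/-- This and the next limits are taken along a convergent sequence, to serve both a fixed angle and
`alphaStar n r`. -/
lemma tendsto_alphaBar {u : ℕ → ℝ} {α : ℝ} (hu : Tendsto u atTop (𝓝 α)) :
    Tendsto (fun n => alphaBar n (u n)) atTop (𝓝 0) :=
  ((hu.const_mul 2).const_sub π).div_atTop tendsto_natCast_sub_two

lemma tendsto_mul_sin_alphaBar {u : ℕ → ℝ} {α : ℝ} (hu : Tendsto u atTop (𝓝 α)) :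
    Tendsto (fun n : ℕ => ((n : ℝ) - 2) * sin (alphaBar n (u n))) atTop (𝓝 (π - 2 * α)) := by
  have h1 : Tendsto (fun n => sinc (alphaBar n (u n))) atTop (𝓝 1) := by
    have := (continuous_sinc.tendsto 0).comp (tendsto_alphaBar hu)
    rwa [sinc_zero] at this
  have h2 := ((hu.const_mul 2).const_sub π).mul h1
  rw [mul_one] at h2
  refine h2.congr' ?_
  filter_upwards [eventually_ge_atTop 3] with n hn
  have hn' : (3 : ℝ) ≤ n := by exact_mod_cast hn
  have hn2 : (n : ℝ) - 2 ≠ 0 := by linarith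
  rcases eq_or_ne (alphaBar n (u n)) 0 with h | h
  · have : π - 2 * u n = 0 := by
      simpa [alphaBar, hn2] using h
    simp [this, h]
  · rw [sinc_of_ne_zero h]
    have e : π - 2 * u n = ((n : ℝ) - 2) * alphaBar n (u n) := by
      unfold alphaBar; field_simp
    rw [e]
    field_simp

lemma eventually_alphaBar_mem {u : ℕ → ℝ} {α : ℝ} (hu : Tendsto u atTop (𝓝 α))
    (hlt : ∀ᶠ n in atTop, u n < π / 2) : ∀ᶠ n in atTop, alphaBar n (u n) ∈ Ioo 0 (π / 2) := by
  filter_upwards [eventually_ge_atTop 3, hlt,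
    (tendsto_alphaBar hu).eventually (gt_mem_nhds (half_pos pi_pos))] with n hn h1 h2
  have hn' : (3 : ℝ) ≤ n := by exact_mod_cast hn
  exact ⟨div_pos (by linarith) (by linarith), h2⟩

lemma tendsto_gdRatio_alphaBar {u : ℕ → ℝ} {α : ℝ} (hu : Tendsto u atTop (𝓝 α))
    (hlt : ∀ᶠ n in atTop, u n < π / 2) :
    Tendsto (fun n => gdRatio (alphaBar n (u n))) atTop (𝓝 1) := by
  refine tendsto_gdRatio.comp (tendsto_nhdsWithin_iff.2 ⟨tendsto_alphaBar hu, ?_⟩)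
  filter_upwards [eventually_alphaBar_mem hu hlt] with n hn using hn.1

lemma tendsto_cos_alphaBar {u : ℕ → ℝ} {α : ℝ} (hu : Tendsto u atTop (𝓝 α)) :
    Tendsto (fun n => cos (alphaBar n (u n))) atTop (𝓝 1) := by
  have := (continuous_cos.tendsto 0).comp (tendsto_alphaBar hu)
  rwa [cos_zero] at this

/-- The area of the region of half-angle `α` and radius `1`. -/
noncomputable def unitArea (α : ℝ) : ℝ := sin (2 * α) + (π - 2 * α)

/-- `lim (n - 2) H(n, r, α)` divided by `π - 2α`. -/
noncomputable def reducedHInf (r α : ℝ) : ℝ :=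
  sin α - cos α ^ 2 * invGd α - r * unitArea α

lemma unitArea_pos {α : ℝ} (hα : α ∈ Ico 0 (π / 2)) : 0 < unitArea α := by
  have : 0 ≤ sin (2 * α) := sin_nonneg_of_nonneg_of_le_pi (by linarith [hα.1]) (by linarith [hα.2])
  unfold unitArea
  linarith [hα.2]

lemma tendsto_angleH {r α : ℝ} (hα : α ∈ Ico 0 (π / 2)) :
    Tendsto (fun n : ℕ => ((n : ℝ) - 2) * angleH n r α) atTop
      (𝓝 ((π - 2 * α) * reducedHInf r α)) := by
  have hu : Tendsto (fun _ : ℕ => α) atTop (𝓝 α) := tendsto_const_nhds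
  have hlt : ∀ᶠ _ in (atTop : Filter ℕ), α < π / 2 := Eventually.of_forall fun _ => hα.2
  have h1 := tendsto_mul_sin_alphaBar hu
  have h3 := (tendsto_cos_alphaBar hu).mul h1
  rw [one_mul] at h3
  have h2 : Tendsto (fun n => reducedH n r α) atTop (𝓝 (reducedHInf r α)) := by
    have h := ((((tendsto_gdRatio_alphaBar hu hlt).const_mul (sin α))).sub_const
      (cos α ^ 2 * invGd α)).sub ((h3.const_add (sin (2 * α))).const_mul r)
    rw [mul_one] at h
    refine h.congr fun n => ?_
    unfold reducedH
    ring
  refine (h1.mul h2).congr' ?_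
  filter_upwards [eventually_alphaBar_mem hu hlt] with n hn
  rw [angleH_eq (sin_pos_of_mem hn).ne']
  ring

lemma angleHInf_eq {r α : ℝ} (hα : α ∈ Ico 0 (π / 2)) :
    angleHInf r α = (π - 2 * α) * reducedHInf r α := (tendsto_angleH hα).limUnder_eq

lemma hasDerivAt_reducedHInf (r : ℝ) {α : ℝ} (hα : α ∈ Ico 0 (π / 2)) :
    HasDerivAt (reducedHInf r) (sin (2 * α) * invGd α + 2 * r * (1 - cos (2 * α))) α := by
  have hc := cos_pos_of_mem hα
  have h2 := (hasDerivAt_sin (2 * α)).comp α ((hasDerivAt_id α).const_mul 2)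
  have h := ((hasDerivAt_sin α).sub (((hasDerivAt_cos α).pow 2).mul (hasDerivAt_invGd hc))).sub
    ((h2.add (((hasDerivAt_id α).const_mul 2).const_sub π)).const_mul r)
  refine h.congr_deriv ?_
  simp only [Pi.pow_apply, Nat.cast_ofNat, mul_one, sin_two_mul]
  field_simp
  ring

lemma strictMonoOn_reducedHInf {r : ℝ} (hr : 0 ≤ r) :
    StrictMonoOn (reducedHInf r) (Ico 0 (π / 2)) := by
  refine strictMonoOn_of_deriv_pos (convex_Ico _ _) ?_ ?_
  · intro α hα
    exact (hasDerivAt_reducedHInf r hα).continuousAt.continuousWithinAt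
  · intro α hα
    rw [interior_Ico] at hα
    have hα' : α ∈ Ico 0 (π / 2) := ⟨hα.1.le, hα.2⟩
    rw [(hasDerivAt_reducedHInf r hα').deriv]
    have h1 : 0 < sin (2 * α) :=
      sin_pos_of_pos_of_lt_pi (by linarith [hα.1]) (by linarith [hα.2])
    have h2 : 0 < invGd α := hα.1.trans_le (self_le_invGd hα')
    have h3 := cos_le_one (2 * α)
    have : 0 ≤ 1 - cos (2 * α) := by linarith
    positivity

lemma existsUnique_angleHInf_root {r : ℝ} (hr : 0 ≤ r) :
    ∃! α : ℝ, α ∈ Ico 0 (π / 2) ∧ angleHInf r α = 0 := by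
  have key : ∀ α ∈ Ico 0 (π / 2), angleHInf r α = 0 ↔ reducedHInf r α = 0 := fun α hα => by
    have : π - 2 * α ≠ 0 := by linarith [hα.2]
    rw [angleHInf_eq hα, mul_eq_zero, or_iff_right this]
  have hlim : Tendsto (fun α => sin α - 2 * cos α - r * unitArea α) (𝓝[<] (π / 2)) (𝓝 1) := by
    have hc : Continuous (fun α => sin α - 2 * cos α - r * unitArea α) := by
      unfold unitArea
      fun_prop
    have h := hc.tendsto (π / 2)
    simp only [unitArea, mul_div_cancel₀ _ (two_ne_zero (α := ℝ)), sin_pi, sub_self, add_zero,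
      mul_zero, sub_zero, sin_pi_div_two, cos_pi_div_two] at h
    exact h.mono_left nhdsWithin_le_nhds
  obtain ⟨β, hβ, hm⟩ := ((hlim.eventually (lt_mem_nhds one_pos)).and
    (Ico_mem_nhdsLT (half_pos pi_pos))).exists
  have hpos : 0 ≤ reducedHInf r β := by
    have := cos_sq_mul_invGd_le (cos_pos_of_mem hm)
    unfold reducedHInf
    linarith
  have hcont : ContinuousOn (reducedHInf r) (Icc 0 β) := fun α hα =>
    (hasDerivAt_reducedHInf r ⟨hα.1, hα.2.trans_lt hm.2⟩).continuousAt.continuousWithinAt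
  have hzero : reducedHInf r 0 ≤ 0 := by
    simp only [reducedHInf, unitArea, sin_zero, invGd_zero, mul_zero]
    have := mul_nonneg hr pi_pos.le
    linarith
  obtain ⟨α, hα, h0⟩ := intermediate_value_Icc hm.1 hcont ⟨hzero, hpos⟩
  have hα' : α ∈ Ico 0 (π / 2) := ⟨hα.1, hα.2.trans_lt hm.2⟩
  refine ⟨α, ⟨hα', (key α hα').2 h0⟩, ?_⟩
  rintro γ ⟨hγ, hγ0⟩
  exact (strictMonoOn_reducedHInf hr).injOn hγ hα' (((key γ hγ).1 hγ0).trans h0.symm)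

lemma alphaInf_spec {r : ℝ} (hr : 0 ≤ r) :
    alphaInf r ∈ Ico 0 (π / 2) ∧ reducedHInf r (alphaInf r) = 0 := by
  obtain ⟨α, hα, hu⟩ := existsUnique_angleHInf_root hr
  have : {α | α ∈ Ico 0 (π / 2) ∧ angleHInf r α = 0} = {α} :=
    eq_singleton_iff_unique_mem.2 ⟨hα, hu⟩
  rw [alphaInf, this, csInf_singleton]
  refine ⟨hα.1, ?_⟩
  have h := hα.2
  have hne : π - 2 * α ≠ 0 := by linarith [hα.1.2]
  rwa [angleHInf_eq hα.1, mul_eq_zero, or_iff_right hne] at h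

/-- Pointwise convergence suffices: on either side of `alphaInf r` the limit function has a strict
sign, which `H(n, r, ·)` inherits at that point for large `n`, and `lt_alphaStar` and `alphaStar_lt`
place the root. That `π / n → 0` brings the point into the interval where they apply. -/
lemma tendsto_alphaStar {r : ℝ} (hr : 0 ≤ r) :
    Tendsto (fun n => alphaStar n r) atTop (𝓝 (alphaInf r)) := by
  obtain ⟨hm, h0⟩ := alphaInf_spec hr
  have hmono := strictMonoOn_reducedHInf hr
  have hdiv : Tendsto (fun n : ℕ => π / n) atTop (𝓝 0) :=
    tendsto_const_nhds.div_atTop tendsto_natCast_atTop_atTop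
  rw [tendsto_order]
  constructor
  · intro a ha
    rcases le_or_gt a 0 with ha0 | ha0
    · filter_upwards [eventually_ge_atTop 3] with n hn
      exact ha0.trans_lt (pos_of_mem hn (alphaStar_spec hn hr).1)
    · have hlt : a < π / 2 := ha.trans hm.2
      have hneg : (π - 2 * a) * reducedHInf r a < 0 := by
        apply mul_neg_of_pos_of_neg (by linarith)
        rw [← h0]
        exact hmono ⟨ha0.le, hlt⟩ hm ha
      filter_upwards [eventually_ge_atTop 3, hdiv.eventually (gt_mem_nhds ha0),
        (tendsto_angleH ⟨ha0.le, hlt⟩).eventually (gt_mem_nhds hneg)] with n hn h1 h2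
      have hn' : (3 : ℝ) ≤ n := by exact_mod_cast hn
      exact lt_alphaStar hn hr ⟨h1.le, hlt⟩ (by_contra fun h => absurd h2
        (not_lt.2 (mul_nonneg (by linarith) (not_lt.1 h))))
  · intro a' ha'
    obtain ⟨a, ha, haa⟩ := exists_between (lt_min ha' hm.2)
    have hlt : a < π / 2 := haa.trans_le (min_le_right _ _)
    have ha0 : 0 < a := hm.1.trans_lt ha
    have hpos : 0 < (π - 2 * a) * reducedHInf r a := by
      apply mul_pos (by linarith)
      rw [← h0]
      exact hmono hm ⟨ha0.le, hlt⟩ ha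
    filter_upwards [eventually_ge_atTop 3, hdiv.eventually (gt_mem_nhds ha0),
      (tendsto_angleH ⟨ha0.le, hlt⟩).eventually (lt_mem_nhds hpos)] with n hn h1 h2
    have hn' : (3 : ℝ) ≤ n := by exact_mod_cast hn
    exact (alphaStar_lt hn hr ⟨h1.le, hlt⟩ (by_contra fun h => absurd h2
      (not_lt.2 (mul_nonpos_of_nonneg_of_nonpos (by linarith) (not_lt.1 h))))).trans
        (haa.trans_le (min_le_left _ _))

/-- Numerator and denominator both vanish like `sin ᾱ`; after cancelling it, every factor converges
and `gdRatio ᾱ → 1`. -/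
lemma tendsto_gFun {r : ℝ} (hr : 0 ≤ r) :
    Tendsto (fun n => gFun n r) atTop
      (𝓝 (3 * √(unitArea (alphaInf r)) / (2 + 4 * r * cos (alphaInf r)))) := by
  obtain ⟨hm, -⟩ := alphaInf_spec hr
  have hu := tendsto_alphaStar hr
  have hlt : ∀ᶠ n in atTop, alphaStar n r < π / 2 := by
    filter_upwards [eventually_ge_atTop 3] with n hn using (alphaStar_spec hn hr).1.2
  have hc := cos_pos_of_mem hm
  have hcos := (continuous_cos.tendsto _).comp hu
  have hsin : Tendsto (fun n => sin (2 * alphaStar n r)) atTop (𝓝 (sin (2 * alphaInf r))) :=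
    (continuous_sin.tendsto _).comp (hu.const_mul 2)
  have h3 := (tendsto_cos_alphaBar hu).mul (tendsto_mul_sin_alphaBar hu)
  rw [one_mul] at h3
  have hnum := ((hsin.add h3).sqrt).const_mul 3
  have hden := ((tendsto_gdRatio_alphaBar hu hlt).const_add 1).add (hcos.const_mul (4 * r))
  have hne : (1 : ℝ) + 1 + 4 * r * cos (alphaInf r) ≠ 0 := by positivity
  have h := hnum.div hden hne
  rw [show (1 : ℝ) + 1 = 2 by norm_num] at h
  refine h.congr' ?_
  filter_upwards [eventually_alphaBar_mem hu hlt] with n hn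
  have hs := sin_pos_of_mem hn
  have e : sin (alphaBar n (alphaStar n r))
      + cos (alphaBar n (alphaStar n r)) ^ 2 *
          log (tan (π / 4 + alphaBar n (alphaStar n r) / 2))
      + 4 * r * sin (alphaBar n (alphaStar n r)) * cos (alphaStar n r) =
      sin (alphaBar n (alphaStar n r)) * (1 + gdRatio (alphaBar n (alphaStar n r)) +
        4 * r * cos (alphaStar n r)) := by
    have h := mul_div_cancel₀
      (cos (alphaBar n (alphaStar n r)) ^ 2 * invGd (alphaBar n (alphaStar n r))) hs.ne'
    rw [mul_add, mul_add, gdRatio, h, invGd]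
    ring
  simp only [Pi.div_apply, Function.comp_apply, gFun]
  rw [e, mul_comm 3 (sin _), mul_assoc (sin _), mul_div_mul_left _ _ hs.ne']
  congr 4
  ring

lemma gInf_eq {r : ℝ} (hr : 0 ≤ r) :
    gInf r = 3 * √(unitArea (alphaInf r)) / (2 + 4 * r * cos (alphaInf r)) :=
  (tendsto_gFun hr).limUnder_eq

lemma gInf_pos {r : ℝ} (hr : 0 ≤ r) : 0 < gInf r := by
  have hm := (alphaInf_spec hr).1
  have := unitArea_pos hm
  have := cos_pos_of_mem hm
  rw [gInf_eq hr]
  positivity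

/-! ### Integration over the plane by slices -/

/-- The coordinates of the plane. -/
noncomputable def planeEquiv : Plane ≃ᵐ ℝ × ℝ :=
  (MeasurableEquiv.toLp 2 (Fin 2 → ℝ)).symm.trans MeasurableEquiv.finTwoArrow

lemma planeEquiv_apply (p : Plane) : planeEquiv p = (p 0, p 1) := rfl

lemma measurePreserving_planeEquiv : MeasurePreserving planeEquiv :=
  (EuclideanSpace.volume_preserving_symm_measurableEquiv_toLp (Fin 2)).trans
    (volume_preserving_finTwoArrow ℝ)

lemma setIntegral_slices {F : ℝ × ℝ → ℝ} (hF : Integrable F) (s : Set ℝ) :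
    ∫ p : Plane in {p | p 0 ∈ s}, F (p 0, p 1) = ∫ x in s, ∫ y, F (x, y) := by
  have h := measurePreserving_planeEquiv.setIntegral_preimage_emb
    planeEquiv.measurableEmbedding F (s ×ˢ univ)
  have e : planeEquiv ⁻¹' (s ×ˢ univ) = {p : Plane | p 0 ∈ s} := by
    ext p; simp [planeEquiv_apply]
  rw [e, Measure.volume_eq_prod, setIntegral_prod F hF.integrableOn] at h
  simpa [planeEquiv_apply] using h

lemma norm_plane (p : Plane) : ‖p‖ = √(p 0 ^ 2 + p 1 ^ 2) := by
  rw [EuclideanSpace.norm_eq, Fin.sum_univ_two]; simp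

lemma norm_plane_sq (p : Plane) : ‖p‖ ^ 2 = p 0 ^ 2 + p 1 ^ 2 := by
  rw [norm_plane, sq_sqrt (by positivity)]

/-! ### Cones, their slices and their integrals over strips -/

/-- The cone `(R - t)₊`. -/
def cone (R t : ℝ) : ℝ := max (R - t) 0

lemma cone_nonneg (R t : ℝ) : 0 ≤ cone R t := le_max_right _ _

lemma cone_antitone (R : ℝ) : Antitone (cone R) := fun _ _ h => by
  unfold cone; gcongr

lemma continuous_cone (R : ℝ) : Continuous (cone R) := by unfold cone; fun_prop

lemma cone_of_le {R t : ℝ} (h : t ≤ R) : cone R t = R - t := max_eq_left (by linarith)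

lemma cone_of_ge {R t : ℝ} (h : R ≤ t) : cone R t = 0 := max_eq_right (by linarith)

lemma integrable_cone_dist (R : ℝ) (c : Plane) : Integrable fun p => cone R (dist p c) := by
  refine Continuous.integrable_of_hasCompactSupport
    ((continuous_cone R).comp (by fun_prop)) ?_
  refine HasCompactSupport.intro (isCompact_closedBall c R) fun p hp => ?_
  exact cone_of_ge (not_le.1 hp).le

lemma integrable_cone_norm (R : ℝ) : Integrable fun p : Plane => cone R ‖p‖ := by
  simpa using integrable_cone_dist R 0

lemma integrable_cone_prod (R : ℝ) :
    Integrable fun q : ℝ × ℝ => cone R (√(q.1 ^ 2 + q.2 ^ 2)) := by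
  have h := (measurePreserving_planeEquiv.integrable_comp_emb planeEquiv.measurableEmbedding
    (g := fun q : ℝ × ℝ => cone R (√(q.1 ^ 2 + q.2 ^ 2)))).1
  apply h
  refine (integrable_cone_norm R).congr (Eventually.of_forall fun p => ?_)
  simp [planeEquiv_apply, norm_plane]

/-- The integral of the cone of height `R` over the line at distance `x` from the apex. -/
noncomputable def coneSlice (R x : ℝ) : ℝ := ∫ y, cone R (√(x ^ 2 + y ^ 2))

/-- The integral of the cone of height `R` over the strip of half-width `h` about the apex. -/
noncomputable def coneStrip (R h : ℝ) : ℝ := ∫ x in -h..h, coneSlice R x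

lemma integrable_coneSlice (R : ℝ) : Integrable (coneSlice R) :=
  (integrable_cone_prod R).integral_prod_left

lemma integrable_cone_slice (R x : ℝ) : Integrable fun y => cone R (√(x ^ 2 + y ^ 2)) := by
  refine Continuous.integrable_of_hasCompactSupport
    ((continuous_cone R).comp (by fun_prop)) ?_
  refine HasCompactSupport.intro (isCompact_closedBall 0 R) fun y hy => ?_
  refine cone_of_ge ?_
  rw [mem_closedBall_zero_iff, not_le] at hy
  refine hy.le.trans ?_
  rw [norm_eq_abs, ← sqrt_sq_eq_abs]
  exact sqrt_le_sqrt (by linarith [sq_nonneg x])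

lemma coneSlice_anti (R : ℝ) {x x' : ℝ} (hx : 0 ≤ x) (h : x ≤ x') :
    coneSlice R x' ≤ coneSlice R x := by
  refine integral_mono (integrable_cone_slice R x') (integrable_cone_slice R x) fun y => ?_
  refine cone_antitone R (sqrt_le_sqrt ?_)
  gcongr

lemma coneStrip_eq (R h : ℝ) : coneStrip R h = 2 * ∫ x in 0..h, coneSlice R x := by
  have hi : ∀ a b, IntervalIntegrable (coneSlice R) volume a b :=
    fun a b => (integrable_coneSlice R).intervalIntegrable
  have h1 : ∫ x in -h..0, coneSlice R x = ∫ x in 0..h, coneSlice R x := by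
    have := intervalIntegral.integral_comp_neg (a := 0) (b := h) (coneSlice R)
    rw [neg_zero] at this
    rw [← this]
    simp [coneSlice]
  rw [coneStrip, ← intervalIntegral.integral_add_adjacent_intervals (hi (-h) 0) (hi 0 h), h1]
  ring

/-- The strip integral is concave in the width. -/
lemma coneStrip_le (R : ℝ) {h₀ h : ℝ} (h₀0 : 0 ≤ h₀) (h0 : 0 ≤ h) :
    coneStrip R h ≤ coneStrip R h₀ + 2 * coneSlice R h₀ * (h - h₀) := by
  have hi : ∀ a b, IntervalIntegrable (coneSlice R) volume a b :=
    fun a b => (integrable_coneSlice R).intervalIntegrable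
  have hc : ∀ a b, IntervalIntegrable (fun _ => coneSlice R h₀) volume a b :=
    fun a b => intervalIntegrable_const
  have hadd := intervalIntegral.integral_add_adjacent_intervals (hi 0 h₀) (hi h₀ h)
  have key : ∫ x in h₀..h, coneSlice R x ≤ coneSlice R h₀ * (h - h₀) := by
    rcases le_total h₀ h with hle | hle
    · have := intervalIntegral.integral_mono_on hle (hi h₀ h) (hc h₀ h)
        fun x hx => coneSlice_anti R h₀0 hx.1
      rw [intervalIntegral.integral_const, smul_eq_mul] at this
      linarith
    · have := intervalIntegral.integral_mono_on hle (hc h h₀) (hi h h₀)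
        fun x hx => coneSlice_anti R (h0.trans hx.1) hx.2
      rw [intervalIntegral.integral_const, smul_eq_mul] at this
      rw [intervalIntegral.integral_symm]
      linarith
  rw [coneStrip_eq, coneStrip_eq, ← hadd]
  linarith

lemma setIntegral_cone_strip (R : ℝ) {h : ℝ} (hh : 0 ≤ h) :
    ∫ p : Plane in {p | p 0 ∈ Ioc (-h) h}, cone R ‖p‖ = coneStrip R h := by
  rw [coneStrip, intervalIntegral.integral_of_le (by linarith)]
  simp only [norm_plane]
  exact setIntegral_slices (integrable_cone_prod R) _

/-! ### The part of a cone above a translate -/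

lemma measurableSet_slab {s : Set ℝ} (hs : MeasurableSet s) :
    MeasurableSet {p : Plane | p 0 ∈ s} :=
  hs.preimage (by fun_prop : Measurable fun p : Plane => p 0)

lemma norm_sub_single (p : Plane) (d : ℝ) :
    ‖p - EuclideanSpace.single 0 d‖ = √((p 0 - d) ^ 2 + p 1 ^ 2) := by
  rw [norm_plane]; simp

/-- The positive part lives on the half-plane `A` on the apex's side of the bisector. Translating
the second cone back to the origin turns its integral over `A` into that of the first cone over the
half-plane `B`, and `A \ B` is the strip. -/
lemma integral_cone_sub_single (R : ℝ) {d : ℝ} (hd : 0 ≤ d) :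
    ∫ p : Plane, max (cone R ‖p‖ - cone R ‖p - EuclideanSpace.single 0 d‖) 0 =
      coneStrip R (d / 2) := by
  set v : Plane := EuclideanSpace.single 0 d with hv
  set A : Set Plane := {p | p 0 ∈ Iic (d / 2)}
  set B : Set Plane := {p | p 0 ∈ Iic (-(d / 2))}
  have hA : MeasurableSet A := measurableSet_slab measurableSet_Iic
  have hB : MeasurableSet B := measurableSet_slab measurableSet_Iic
  have h1 : ∀ p : Plane, max (cone R ‖p‖ - cone R ‖p - v‖) 0 =
      A.indicator (fun p => cone R ‖p‖) p - B.indicator (fun p => cone R ‖p‖) (p - v) := by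
    intro p
    have hAB : p - v ∈ B ↔ p ∈ A := by
      simp only [A, B, mem_ofPred_eq, mem_Iic, hv, PiLp.sub_apply, PiLp.single_apply, if_true]
      constructor <;> intro h <;> linarith
    by_cases hp : p ∈ A
    · rw [indicator_of_mem hp, indicator_of_mem (hAB.2 hp), max_eq_left]
      refine sub_nonneg.2 (cone_antitone R ?_)
      rw [hv, norm_sub_single, norm_plane]
      have hp' : p 0 ≤ d / 2 := hp
      exact sqrt_le_sqrt (by nlinarith)
    · rw [indicator_of_notMem hp, indicator_of_notMem (mt hAB.1 hp), sub_self, max_eq_right]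
      refine sub_nonpos.2 (cone_antitone R ?_)
      rw [hv, norm_sub_single, norm_plane]
      have hp' : d / 2 < p 0 := not_le.1 hp
      exact sqrt_le_sqrt (by nlinarith)
  have hi := integrable_cone_norm R
  have h2 : ∀ p : Plane, A.indicator (fun p => cone R ‖p‖) p - B.indicator (fun p => cone R ‖p‖) p =
      {p : Plane | p 0 ∈ Ioc (-(d / 2)) (d / 2)}.indicator (fun p => cone R ‖p‖) p := by
    intro p
    by_cases hpA : p 0 ≤ d / 2 <;> by_cases hpB : p 0 ≤ -(d / 2)
    · have : ¬ (-(d / 2) < p 0) := not_lt.2 hpB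
      simp [indicator, A, B, hpA, hpB, this]
    · have : -(d / 2) < p 0 := not_le.1 hpB
      simp [indicator, A, B, hpA, hpB, this]
    · linarith
    · simp [indicator, A, B, hpA, hpB]
  simp_rw [h1]
  rw [integral_sub (hi.indicator hA) ((hi.indicator hB).comp_sub_right v),
    integral_sub_right_eq_self (B.indicator fun p => cone R ‖p‖) v,
    ← integral_sub (hi.indicator hA) (hi.indicator hB)]
  simp_rw [h2]
  rw [integral_indicator (measurableSet_slab measurableSet_Ioc),
    setIntegral_cone_strip R (by linarith)]

/-- After a translation of `a` to the origin, a reflection takes `b - a` to the first axis, which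
reduces this to `integral_cone_sub_single`. -/
lemma integral_cone_sub (R : ℝ) (a b : Plane) :
    ∫ p : Plane, max (cone R (dist p a) - cone R (dist p b)) 0 = coneStrip R (dist a b / 2) := by
  have hnorm : ‖b - a‖ = ‖(EuclideanSpace.single 0 (dist a b) : Plane)‖ := by
    simp [dist_eq_norm, norm_sub_rev a b]
  set ρ := Submodule.reflection (ℝ ∙ ((b - a) - (EuclideanSpace.single 0 (dist a b) : Plane)))ᗮ
  have hρ : ρ (b - a) = EuclideanSpace.single 0 (dist a b) := Submodule.reflection_sub hnorm
  rw [← integral_cone_sub_single R dist_nonneg,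
    ← integral_add_right_eq_self _ a,
    ← ρ.measurePreserving.integral_comp ρ.toHomeomorph.measurableEmbedding
      (fun p => max (cone R ‖p‖ - cone R ‖p - EuclideanSpace.single 0 (dist a b)‖) 0)]
  refine integral_congr_ae (Eventually.of_forall fun p => ?_)
  simp only
  rw [← hρ, ← map_sub, ρ.norm_map, ρ.norm_map, dist_eq_norm, dist_eq_norm]
  rw [add_sub_cancel_right, show p + a - b = p - (b - a) by abel]

lemma integral_cone_dist (R : ℝ) (c : Plane) :
    ∫ p, cone R (dist p c) = ∫ p : Plane, cone R ‖p‖ := by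
  rw [← integral_add_right_eq_self _ c]
  simp [dist_eq_norm]

/-- A cylinder in place of the cone: only the order `R³` matters, as this single term is later
divided by `N`. -/
lemma integral_cone_le {R : ℝ} (hR : 0 ≤ R) : ∫ p : Plane, cone R ‖p‖ ≤ π * R ^ 3 := by
  have h1 : ∀ p : Plane, cone R ‖p‖ ≤ (Metric.ball 0 R).indicator (fun _ => R) p := by
    intro p
    by_cases hp : p ∈ Metric.ball (0 : Plane) R
    · rw [indicator_of_mem hp]
      exact max_le (by linarith [norm_nonneg p]) hR
    · rw [indicator_of_notMem hp, cone_of_ge]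
      simpa using hp
  have h2 : Integrable ((Metric.ball (0 : Plane) R).indicator fun _ => R) :=
    (integrable_indicator_iff measurableSet_ball).2
      (integrableOn_const (measure_ball_lt_top).ne)
  refine (integral_mono (integrable_cone_norm R) h2 h1).trans ?_
  rw [integral_indicator measurableSet_ball, setIntegral_const, smul_eq_mul, measureReal_def,
    EuclideanSpace.volume_ball_fin_two]
  rw [ENNReal.toReal_mul, ENNReal.toReal_pow, ENNReal.toReal_ofReal hR,
    ENNReal.toReal_ofReal pi_pos.le]
  exact le_of_eq (by ring)

/-! ### Explicit integrals -/

lemma coneSlice_eq {R x : ℝ} (hx : 0 < x) (hxR : x ≤ R) :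
    coneSlice R x =
      R * √(R ^ 2 - x ^ 2) - x ^ 2 * (log (R + √(R ^ 2 - x ^ 2)) - log x) := by
  have hnn : 0 ≤ R ^ 2 - x ^ 2 := by nlinarith
  set s := √(R ^ 2 - x ^ 2) with hs
  have hs0 : 0 ≤ s := sqrt_nonneg _
  have hs2 : s ^ 2 = R ^ 2 - x ^ 2 := sq_sqrt hnn
  have hR : 0 < R := hx.trans_le hxR
  have hsR : s < R := by nlinarith [pow_pos hx 2]
  have hlow : ∀ y, y ∈ Icc (-s) s → √(x ^ 2 + y ^ 2) ≤ R := fun y hy => by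
    rw [sqrt_le_left hR.le]
    nlinarith [abs_le.2 hy, sq_abs y, sq_le_sq' hy.1 hy.2]
  have hout : ∀ y, y ∉ Ioc (-s) s → R ≤ √(x ^ 2 + y ^ 2) := fun y hy => by
    apply le_sqrt_of_sq_le
    rw [mem_Ioc, not_and_or, not_lt, not_le] at hy
    rcases hy with hy | hy <;> nlinarith
  have h1 : coneSlice R x = ∫ y in -s..s, cone R (√(x ^ 2 + y ^ 2)) := by
    rw [coneSlice, intervalIntegral.integral_eq_integral_of_support_subset]
    intro y hy
    by_contra h
    exact hy (cone_of_ge (hout y h))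
  have h2 : ∫ y in -s..s, cone R (√(x ^ 2 + y ^ 2)) = ∫ y in -s..s, (R - √(x ^ 2 + y ^ 2)) := by
    refine intervalIntegral.integral_congr fun y hy => ?_
    rw [uIcc_of_le (by linarith)] at hy
    exact cone_of_le (hlow y hy)
  have hD : ∀ y ∈ uIcc (-s) s, HasDerivAt
      (fun y => R * y - (y * √(x ^ 2 + y ^ 2) + x ^ 2 * log (y + √(x ^ 2 + y ^ 2))) / 2)
      (R - √(x ^ 2 + y ^ 2)) y := by
    intro y _
    have hp : 0 < x ^ 2 + y ^ 2 := by positivity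
    have hq : 0 < √(x ^ 2 + y ^ 2) := sqrt_pos.2 hp
    have hq2 : √(x ^ 2 + y ^ 2) ^ 2 = x ^ 2 + y ^ 2 := sq_sqrt hp.le
    have hadd : 0 < y + √(x ^ 2 + y ^ 2) := by
      have : |y| < √(x ^ 2 + y ^ 2) := by
        rw [← sqrt_sq_eq_abs]
        exact sqrt_lt_sqrt (sq_nonneg y) (by linarith [pow_pos hx 2])
      linarith [neg_abs_le y]
    have hq' := (((hasDerivAt_id y).pow 2).const_add (x ^ 2)).sqrt (by simpa using hp.ne')
    have hl := ((hasDerivAt_id y).add hq').log (by simpa using hadd.ne')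
    have h := ((hasDerivAt_id y).const_mul R).sub
      ((((hasDerivAt_id y).mul hq').add (hl.const_mul (x ^ 2))).div_const 2)
    refine h.congr_deriv ?_
    simp only [Pi.pow_apply, id, Pi.add_apply]
    generalize √(x ^ 2 + y ^ 2) = q at *
    field_simp
    norm_num
    linear_combination (y * 2 + q * 2) * hq2
  have hcont : Continuous fun y => R - √(x ^ 2 + y ^ 2) := by fun_prop
  rw [h1, h2, intervalIntegral.integral_eq_sub_of_hasDerivAt hD (hcont.intervalIntegrable _ _)]
  have e : √(x ^ 2 + s ^ 2) = R := by
    rw [hs2, add_sub_cancel, sqrt_sq hR.le]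
  -- Rationalisation: `(R - s)(R + s) = x²`.
  have hlog : log (-s + R) = 2 * log x - log (s + R) := by
    have : -s + R = x ^ 2 / (s + R) := by
      field_simp
      nlinarith
    rw [this, log_div (by positivity) (by positivity), log_pow]
    push_cast
    ring
  rw [neg_sq, e, hlog, add_comm s R]
  ring

lemma sqrt_sq_sub_cos {R α : ℝ} (hR : 0 ≤ R) (hs : 0 ≤ sin α) :
    √(R ^ 2 - (R * cos α) ^ 2) = R * sin α := by
  rw [show R ^ 2 - (R * cos α) ^ 2 = (R * sin α) ^ 2 by
    linear_combination (-R ^ 2) * sin_sq_add_cos_sq α, sqrt_sq (by positivity)]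

lemma log_sub_log_cos {R α : ℝ} (hR : 0 < R) (hs : 0 ≤ sin α) (hc : 0 < cos α) :
    log (R + R * sin α) - log (R * cos α) = invGd α := by
  rw [invGd_eq hc, ← log_div (by positivity) (by positivity),
    show R + R * sin α = R * (1 + sin α) by ring, mul_div_mul_left _ _ hR.ne']

lemma sin_nonneg_of_mem {x : ℝ} (hx : x ∈ Ico 0 (π / 2)) : 0 ≤ sin x :=
  sin_nonneg_of_nonneg_of_le_pi hx.1 (by linarith [hx.2, pi_pos])

lemma coneSlice_cos {R α : ℝ} (hR : 0 < R) (hα : α ∈ Ico 0 (π / 2)) :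
    coneSlice R (R * cos α) = R ^ 2 * (sin α - cos α ^ 2 * invGd α) := by
  have hc := cos_pos_of_mem hα
  have hs := sin_nonneg_of_mem hα
  rw [coneSlice_eq (by positivity) (by nlinarith [cos_le_one α]), sqrt_sq_sub_cos hR.le hs,
    log_sub_log_cos hR hs hc]
  ring

lemma arcsin_cos {α : ℝ} (hα : α ∈ Ico 0 (π / 2)) : arcsin (cos α) = π / 2 - α := by
  rw [← sin_pi_div_two_sub, arcsin_sin] <;> linarith [hα.1, hα.2]

lemma hasDerivAt_sqrt_sq_sub {R x : ℝ} (h : 0 < R ^ 2 - x ^ 2) :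
    HasDerivAt (fun x => √(R ^ 2 - x ^ 2)) (-x / √(R ^ 2 - x ^ 2)) x := by
  have := (((hasDerivAt_id x).pow 2).const_sub (R ^ 2)).sqrt (by simpa using h.ne')
  refine this.congr_deriv ?_
  simp only [Pi.pow_apply, id]
  field_simp
  norm_num

lemma hasDerivAt_arcsin_div {R x : ℝ} (hR : 0 < R) (h : 0 < R ^ 2 - x ^ 2) :
    HasDerivAt (fun x => arcsin (x / R)) (1 / √(R ^ 2 - x ^ 2)) x := by
  have hlt : |x| < R := abs_lt_of_sq_lt_sq (by linarith) hR.le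
  have h1 : x / R ≠ -1 := by
    intro h; rw [div_eq_iff hR.ne'] at h; linarith [(abs_lt.1 hlt).1]
  have h2 : x / R ≠ 1 := by
    intro h; rw [div_eq_iff hR.ne'] at h; linarith [(abs_lt.1 hlt).2]
  have := (hasDerivAt_arcsin h1 h2).comp x ((hasDerivAt_id x).div_const R)
  refine this.congr_deriv ?_
  have e : √(R ^ 2 - x ^ 2) = R * √(1 - (x / R) ^ 2) := by
    rw [show R ^ 2 - x ^ 2 = R ^ 2 * (1 - (x / R) ^ 2) by field_simp,
      sqrt_mul (sq_nonneg R), sqrt_sq hR.le]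
  rw [e, div_mul_div_comm, mul_one, mul_comm]

lemma integral_coneSlice {R h : ℝ} (hR : 0 < R) (h0 : 0 ≤ h) (hh : h ≤ R) :
    2 * ∫ x in 0..h, coneSlice R x = 2 / 3 * R ^ 3 * arcsin (h / R)
      + 4 / 3 * R * h * √(R ^ 2 - h ^ 2)
      - 2 / 3 * h ^ 3 * (log (R + √(R ^ 2 - h ^ 2)) - log h) := by
  -- Writing `x³ log x` as `x² (x log x)` makes the primitive visibly continuous at 0, where
  -- `coneSlice_eq` is not available.
  have hcont : ContinuousOn (fun x => 2 / 3 * R ^ 3 * arcsin (x / R)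
      + 4 / 3 * R * x * √(R ^ 2 - x ^ 2)
      - 2 / 3 * (x ^ 3 * log (R + √(R ^ 2 - x ^ 2)) - x ^ 2 * (x * log x))) (Icc 0 h) := by
    have h1 : Continuous fun x => log (R + √(R ^ 2 - x ^ 2)) :=
      Continuous.log (by fun_prop) fun x => (add_pos_of_pos_of_nonneg hR (sqrt_nonneg _)).ne'
    have h2 := continuous_mul_log
    have h3 : Continuous fun x => arcsin (x / R) := continuous_arcsin.comp (by fun_prop)
    exact Continuous.continuousOn (by fun_prop)
  have hD : ∀ x ∈ Ioo 0 h, HasDerivAt (fun x => 2 / 3 * R ^ 3 * arcsin (x / R)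
      + 4 / 3 * R * x * √(R ^ 2 - x ^ 2)
      - 2 / 3 * (x ^ 3 * log (R + √(R ^ 2 - x ^ 2)) - x ^ 2 * (x * log x)))
      (2 * coneSlice R x) x := by
    intro x hx
    have hxR : x < R := hx.2.trans_le hh
    have hx0 : 0 < x := hx.1
    have hp : 0 < R ^ 2 - x ^ 2 := by nlinarith
    have hs := sqrt_pos.2 hp
    have hs2 := sq_sqrt hp.le
    have ds := hasDerivAt_sqrt_sq_sub hp
    have da := hasDerivAt_arcsin_div hR hp
    have dl := (ds.const_add R).log (add_pos hR hs).ne'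
    have dx := hasDerivAt_id x
    have h := ((da.const_mul (2 / 3 * R ^ 3)).add ((dx.const_mul (4 / 3 * R)).mul ds)).sub
      ((((dx.pow 3).mul dl).sub ((dx.pow 2).mul (dx.mul (hasDerivAt_log hx0.ne')))).const_mul
        (2 / 3))
    rw [coneSlice_eq hx0 hxR.le]
    refine h.congr_deriv ?_
    simp only [Pi.pow_apply, Pi.mul_apply, id]
    generalize √(R ^ 2 - x ^ 2) = s at *
    generalize log (R + s) = l
    generalize log x = l'
    have hRs : R + s ≠ 0 := by positivity
    field_simp
    norm_num
    linear_combination (-2 * R * (R + s) + 2 * x ^ 2) * hs2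
  have hint : IntervalIntegrable (fun x => 2 * coneSlice R x) volume 0 h :=
    ((integrable_coneSlice R).const_mul 2).intervalIntegrable
  rw [← intervalIntegral.integral_const_mul,
    intervalIntegral.integral_eq_sub_of_hasDerivAt_of_le h0 hcont hD hint]
  simp only [zero_div, arcsin_zero]
  ring

lemma coneStrip_cos {R α : ℝ} (hR : 0 < R) (hα : α ∈ Ico 0 (π / 2)) :
    coneStrip R (R * cos α) = R ^ 3 * ((π - 2 * α) / 3 + 4 / 3 * (cos α * sin α)
      - 2 / 3 * cos α ^ 3 * invGd α) := by
  have hc := cos_pos_of_mem hα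
  have hs := sin_nonneg_of_mem hα
  rw [coneStrip_eq, integral_coneSlice hR (by positivity) (by nlinarith [cos_le_one α]),
    sqrt_sq_sub_cos hR.le hs, log_sub_log_cos hR hs hc, mul_div_cancel_left₀ _ hR.ne',
    arcsin_cos hα]
  ring

lemma integral_two_sqrt {R α : ℝ} (hR : 0 < R) (hα : α ∈ Ico 0 (π / 2)) :
    ∫ x in -(R * cos α)..R * cos α, 2 * √(R ^ 2 - x ^ 2) = R ^ 2 * unitArea α := by
  have hc := cos_pos_of_mem hα
  have hs := sin_nonneg_of_mem hα
  have hcR : R * cos α ≤ R := by nlinarith [cos_le_one α]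
  have hRc : 0 < R * cos α := by positivity
  have hcont : ContinuousOn (fun x => R ^ 2 * arcsin (x / R) + x * √(R ^ 2 - x ^ 2))
      (Icc (-(R * cos α)) (R * cos α)) := by
    have h3 : Continuous fun x => arcsin (x / R) := continuous_arcsin.comp (by fun_prop)
    exact Continuous.continuousOn (by fun_prop)
  -- Only the open interval: for `α = 0` the endpoints are `±R`, where root and arcsine are not
  -- differentiable.
  have hD : ∀ x ∈ Ioo (-(R * cos α)) (R * cos α),
      HasDerivAt (fun x => R ^ 2 * arcsin (x / R) + x * √(R ^ 2 - x ^ 2))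
        (2 * √(R ^ 2 - x ^ 2)) x := by
    intro x hx
    have hp : 0 < R ^ 2 - x ^ 2 := by nlinarith [hx.1, hx.2]
    have hsp := sqrt_pos.2 hp
    have hs2 := sq_sqrt hp.le
    have h := ((hasDerivAt_arcsin_div hR hp).const_mul (R ^ 2)).add
      ((hasDerivAt_id x).mul (hasDerivAt_sqrt_sq_sub hp))
    refine h.congr_deriv ?_
    simp only [id]
    generalize √(R ^ 2 - x ^ 2) = s at *
    field_simp
    linear_combination -hs2
  have hi : Continuous fun x => 2 * √(R ^ 2 - x ^ 2) := by fun_prop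
  rw [intervalIntegral.integral_eq_sub_of_hasDerivAt_of_le (by linarith) hcont hD
    (hi.intervalIntegrable _ _), neg_sq, sqrt_sq_sub_cos hR.le hs, neg_div, arcsin_neg,
    mul_div_cancel_left₀ _ hR.ne', arcsin_cos hα, unitArea, sin_two_mul]
  ring

/-! ### The idealized region is a truncated disc -/

/-- The disc of radius `R` about `c`, truncated at distance `R cos α` on both sides. -/
def truncDisc (c : Plane) (R α : ℝ) : Set Plane :=
  {p | ‖p - c‖ ≤ R ∧ |p 0 - c 0| ≤ R * cos α}

lemma dir_zero (θ : ℝ) : dir θ 0 = cos θ := rfl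

lemma dir_one (θ : ℝ) : dir θ 1 = sin θ := rfl

lemma norm_dir (θ : ℝ) : ‖dir θ‖ = 1 := by
  rw [norm_plane, dir_zero, dir_one, cos_sq_add_sin_sq, sqrt_one]

lemma plane_ext {p q : Plane} (h0 : p 0 = q 0) (h1 : p 1 = q 1) : p = q := by
  ext i; fin_cases i <;> assumption

lemma convex_truncDisc (c : Plane) (R α : ℝ) : Convex ℝ (truncDisc c R α) := by
  have e : truncDisc c R α = Metric.closedBall c R ∩
      (EuclideanSpace.proj (𝕜 := ℝ) (0 : Fin 2)).toLinearMap ⁻¹'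
        Metric.closedBall (c 0) (R * cos α) := by
    ext p
    simp [truncDisc, dist_eq_norm]
  rw [e]
  exact (convex_closedBall _ _).inter ((convex_closedBall _ _).linear_preimage _)

lemma add_smul_dir_mem {c : Plane} {R α ρ θ : ℝ} (hρ : ρ ∈ Icc 0 R)
    (h : |cos θ| ≤ cos α) : c + ρ • dir θ ∈ truncDisc c R α := by
  constructor
  · rw [add_sub_cancel_left, norm_smul, norm_dir, mul_one, norm_eq_abs, abs_of_nonneg hρ.1]
    exact hρ.2
  · simp only [PiLp.add_apply, PiLp.smul_apply, add_sub_cancel_left, dir_zero, smul_eq_mul,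
      abs_mul, abs_of_nonneg hρ.1]
    exact mul_le_mul hρ.2 h (abs_nonneg _) (hρ.1.trans hρ.2)

lemma abs_cos_le {α θ : ℝ} (hα : 0 ≤ α) (h : θ ∈ Icc α (π - α)) : |cos θ| ≤ cos α := by
  rw [abs_le, ← cos_pi_sub]
  exact ⟨cos_le_cos_of_nonneg_of_le_pi (hα.trans h.1) (by linarith) h.2,
    cos_le_cos_of_nonneg_of_le_pi hα (by linarith [h.2]) h.1⟩

lemma isoTriangle_subset {c : Plane} {R α θ₁ θ₂ : ℝ} (hR : 0 ≤ R) (hα : 0 ≤ cos α)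
    (h₁ : |cos θ₁| ≤ cos α) (h₂ : |cos θ₂| ≤ cos α) :
    isoTriangle c R θ₁ θ₂ ⊆ truncDisc c R α := by
  refine convexHull_min ?_ (convex_truncDisc c R α)
  rintro p (rfl | rfl | rfl)
  · simp only [truncDisc, mem_ofPred_eq, sub_self, norm_zero, abs_zero]
    exact ⟨hR, by positivity⟩
  · exact add_smul_dir_mem ⟨hR, le_rfl⟩ h₁
  · exact add_smul_dir_mem ⟨hR, le_rfl⟩ h₂

/-- Barycentric coordinates `a`, `b` of the point with respect to the two outer vertices. For `α >
0` they are quotients of sines with `a + b = ρ cos θ / (R cos α)`, so the hypothesis on `ρ cos θ` is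
`a + b ≤ 1`. For `α = 0` the triangle is a segment. -/
lemma mem_isoTriangle {c : Plane} {R α ρ φ θ : ℝ} (hR : 0 < R) (hα : α ∈ Ico 0 (π / 2))
    (hρ : 0 ≤ ρ) (hθ : θ ∈ Icc (-α) α) (h : ρ * cos θ ≤ R * cos α) :
    c + ρ • dir (φ + θ) ∈ isoTriangle c R (φ - α) (φ + α) := by
  have hc := cos_pos_of_mem hα
  obtain ⟨a, b, ha, hb, hab, h0, h1⟩ : ∃ a b : ℝ, 0 ≤ a ∧ 0 ≤ b ∧ a + b ≤ 1 ∧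
      ρ * cos (φ + θ) = a * (R * cos (φ - α)) + b * (R * cos (φ + α)) ∧
      ρ * sin (φ + θ) = a * (R * sin (φ - α)) + b * (R * sin (φ + α)) := by
    rcases hα.1.eq_or_lt with h0 | h0
    · have hθ0 : θ = 0 := by
        have := hθ.1; have := hθ.2; linarith
      subst hθ0
      rw [← h0] at h ⊢
      rw [cos_zero, mul_one, mul_one] at h
      refine ⟨ρ / R, 0, by positivity, le_rfl, ?_, ?_, ?_⟩
      · rw [add_zero, div_le_one hR]; exact h
      · simp; field_simp
      · simp; field_simp
    · have hs : 0 < sin α := sin_pos_of_mem ⟨h0, hα.2⟩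
      have hp := pi_pos
      have s1 : 0 ≤ sin (α - θ) :=
        sin_nonneg_of_nonneg_of_le_pi (by linarith [hθ.2]) (by linarith [hθ.1, hα.2])
      have s2 : 0 ≤ sin (α + θ) :=
        sin_nonneg_of_nonneg_of_le_pi (by linarith [hθ.1]) (by linarith [hθ.2, hα.2])
      have e := sin_sq_add_cos_sq α
      refine ⟨ρ * sin (α - θ) / (R * (2 * sin α * cos α)),
        ρ * sin (α + θ) / (R * (2 * sin α * cos α)), by positivity, by positivity, ?_, ?_, ?_⟩
      · rw [← add_div, div_le_one (by positivity), sin_sub, sin_add]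
        nlinarith [mul_le_mul_of_nonneg_left h (mul_nonneg zero_le_two hs.le)]
      · rw [sin_sub, sin_add α θ, cos_add φ θ, cos_add, cos_sub]
        field_simp
        ring
      · rw [sin_sub α θ, sin_add α θ, sin_add φ θ, sin_sub, sin_add]
        field_simp
        ring
  have hconv : Convex ℝ (isoTriangle c R (φ - α) (φ + α)) := convex_convexHull ℝ _
  have m0 : c ∈ isoTriangle c R (φ - α) (φ + α) := subset_convexHull ℝ _ (by simp)
  have m1 : c + R • dir (φ - α) ∈ isoTriangle c R (φ - α) (φ + α) :=
    subset_convexHull ℝ _ (by simp)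
  have m2 : c + R • dir (φ + α) ∈ isoTriangle c R (φ - α) (φ + α) :=
    subset_convexHull ℝ _ (by simp)
  have hsum := hconv.sum_mem (t := Finset.univ) (w := ![1 - a - b, a, b])
    (z := ![c, c + R • dir (φ - α), c + R • dir (φ + α)])
    (by intro i _; fin_cases i <;> simp <;> linarith)
    (by simp [Fin.sum_univ_three]; ring)
    (by intro i _; fin_cases i <;> simpa)
  convert hsum using 1
  rw [Fin.sum_univ_three]
  apply plane_ext
  · simp [dir_zero, h0]; ring
  · simp [dir_one, h1]; ring

/-- The angle is normalised to start at `-α`, so that the four pieces of the ideal region are met in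
order. -/
lemma exists_polar (v : Plane) (α : ℝ) :
    ∃ θ ∈ Ico (-α) (2 * π - α), v = ‖v‖ • dir θ := by
  set z : ℂ := ⟨v 0, v 1⟩
  have hz : ‖z‖ = ‖v‖ := by
    rw [norm_plane, Complex.norm_eq_sqrt_sq_add_sq]
  set θ := toIcoMod two_pi_pos (-α) z.arg with hθ
  have hm := toIcoMod_mem_Ico two_pi_pos (-α) z.arg
  have e : θ = z.arg - (toIcoDiv two_pi_pos (-α) z.arg : ℤ) * (2 * π) := by
    rw [hθ, toIcoMod, zsmul_eq_mul]
  refine ⟨θ, ⟨hm.1, hm.2.trans_eq (by ring)⟩, plane_ext ?_ ?_⟩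
  · rw [PiLp.smul_apply, dir_zero, e, cos_sub_int_mul_two_pi, smul_eq_mul, ← hz,
      Complex.norm_mul_cos_arg]
  · rw [PiLp.smul_apply, dir_one, e, sin_sub_int_mul_two_pi, smul_eq_mul, ← hz,
      Complex.norm_mul_sin_arg]

/-- In polar coordinates the truncation `|ρ cos θ| ≤ R cos α` is automatic for the directions of the
sectors, and cuts off the outer side of the triangles in the other directions. -/
lemma idealRegion_eq (c : Plane) {R α : ℝ} (hR : 0 < R) (hα : α ∈ Ico 0 (π / 2)) :
    idealRegion c R α = truncDisc c R α := by
  have hc := cos_pos_of_mem hα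
  apply Subset.antisymm
  · refine union_subset (union_subset ?_ ?_) (union_subset ?_ ?_)
    · refine isoTriangle_subset hR.le hc.le ?_ ?_ <;> simp [abs_of_pos hc]
    · refine isoTriangle_subset hR.le hc.le ?_ ?_
      · rw [cos_pi_sub, abs_neg, abs_of_pos hc]
      · rw [add_comm, cos_add_pi, abs_neg, abs_of_pos hc]
    · rintro p ⟨ρ, hρ, θ, hθ, rfl⟩
      exact add_smul_dir_mem hρ (abs_cos_le hα.1 hθ)
    · rintro p ⟨ρ, hρ, θ, hθ, rfl⟩
      refine add_smul_dir_mem hρ ?_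
      rw [← cos_two_pi_sub]
      exact abs_cos_le hα.1 ⟨by linarith [hθ.2], by linarith [hθ.1]⟩
  · rintro p ⟨h1, h2⟩
    obtain ⟨θ, hθ, hv⟩ := exists_polar (p - c) α
    have hp : p = c + ‖p - c‖ • dir θ := by rw [← hv]; abel
    have h0 : p 0 - c 0 = ‖p - c‖ * cos θ := by
      have := congrArg (fun q : Plane => q 0) hv
      simpa [dir_zero] using this
    rw [h0, abs_le] at h2
    have hρ := norm_nonneg (p - c)
    rw [hp]
    rcases le_total θ α with ha | ha
    · refine Or.inl (Or.inl ?_)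
      have := mem_isoTriangle (c := c) (φ := 0) hR hα hρ ⟨hθ.1, ha⟩ h2.2
      simpa using this
    rcases le_total θ (π - α) with hb | hb
    · exact Or.inr (Or.inl ⟨_, ⟨hρ, h1⟩, θ, ⟨ha, hb⟩, rfl⟩)
    rcases le_total θ (π + α) with hd | hd
    · refine Or.inl (Or.inr ?_)
      have := mem_isoTriangle (c := c) (φ := π) (θ := θ - π) hR hα hρ
        ⟨by linarith, by linarith⟩ (by rw [cos_sub_pi]; linarith [h2.1])
      simpa using this
    · exact Or.inr (Or.inr ⟨_, ⟨hρ, h1⟩, θ, ⟨hd, hθ.2.le⟩, rfl⟩)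

/-! ### Area and outbound travel -/

lemma measurableSet_truncDisc (c : Plane) (R α : ℝ) : MeasurableSet (truncDisc c R α) := by
  have h1 : IsClosed (truncDisc c R α) := by
    have : truncDisc c R α = {p | ‖p - c‖ ≤ R} ∩ {p | |p 0 - c 0| ≤ R * cos α} := rfl
    rw [this]
    exact (isClosed_le (by fun_prop) continuous_const).inter
      (isClosed_le (by fun_prop) continuous_const)
  exact h1.measurableSet

lemma preimage_sub_truncDisc (c : Plane) (R α : ℝ) :
    (fun p => p - c) ⁻¹' truncDisc 0 R α = truncDisc c R α := by
  ext p; simp [truncDisc]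

lemma mem_truncDisc_zero {R α : ℝ} (hR : 0 < R) {p : Plane} :
    p ∈ truncDisc 0 R α ↔
      p 0 ∈ Icc (-(R * cos α)) (R * cos α) ∧ p 0 ^ 2 + p 1 ^ 2 ≤ R ^ 2 := by
  simp only [truncDisc, mem_ofPred_eq, sub_zero, PiLp.zero_apply, mem_Icc, abs_le]
  rw [and_comm, ← norm_plane_sq, sq_le_sq₀ (norm_nonneg p) hR.le]

lemma volume_truncDisc_lt_top (c : Plane) (R α : ℝ) : volume (truncDisc c R α) < ⊤ := by
  refine (measure_mono (t := Metric.closedBall c R) ?_).trans_lt measure_closedBall_lt_top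
  intro p hp
  rw [Metric.mem_closedBall, dist_eq_norm]
  exact hp.1

lemma area_truncDisc (c : Plane) {R α : ℝ} (hR : 0 < R) (hα : α ∈ Ico 0 (π / 2)) :
    area (truncDisc c R α) = R ^ 2 * unitArea α := by
  have hc := cos_pos_of_mem hα
  have hRc : 0 < R * cos α := by positivity
  have hcR : R * cos α ≤ R := by nlinarith [cos_le_one α]
  have htrans : volume (truncDisc c R α) = volume (truncDisc 0 R α) := by
    rw [← preimage_sub_truncDisc]
    exact (measurePreserving_sub_right volume c).measure_preimage
      (measurableSet_truncDisc 0 R α).nullMeasurableSet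
  set D : Set (ℝ × ℝ) := {q | q.1 ^ 2 + q.2 ^ 2 ≤ R ^ 2} with hDdef
  have hD : MeasurableSet D := (isClosed_le (by fun_prop) continuous_const).measurableSet
  have hfin : volume D ≠ ⊤ := by
    refine ((measure_mono (t := Metric.closedBall 0 R) ?_).trans_lt
      measure_closedBall_lt_top).ne
    intro q hq
    have hq' : q.1 ^ 2 + q.2 ^ 2 ≤ R ^ 2 := hq
    rw [mem_closedBall_zero_iff, Prod.norm_def, max_le_iff, norm_eq_abs, norm_eq_abs]
    exact ⟨abs_le_of_sq_le_sq (by nlinarith) hR.le, abs_le_of_sq_le_sq (by nlinarith) hR.le⟩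
  have hF : Integrable (D.indicator fun _ => (1 : ℝ)) :=
    (integrable_indicator_iff hD).2 (integrableOn_const hfin)
  have h1 := setIntegral_slices hF (Icc (-(R * cos α)) (R * cos α))
  have h2 : ∫ p : Plane in {p | p 0 ∈ Icc (-(R * cos α)) (R * cos α)},
      D.indicator (fun _ => (1 : ℝ)) (p 0, p 1) = area (truncDisc 0 R α) := by
    rw [← integral_indicator (measurableSet_slab measurableSet_Icc)]
    have : ∀ p : Plane, {p : Plane | p 0 ∈ Icc (-(R * cos α)) (R * cos α)}.indicator
        (fun p => D.indicator (fun _ => (1 : ℝ)) (p 0, p 1)) p =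
        (truncDisc 0 R α).indicator (fun _ => 1) p := by
      intro p
      by_cases ha : p 0 ∈ Icc (-(R * cos α)) (R * cos α) <;>
      by_cases hb : p 0 ^ 2 + p 1 ^ 2 ≤ R ^ 2 <;>
      simp only [indicator, mem_truncDisc_zero hR, mem_ofPred_eq, ha, hb, hDdef, and_true,
        and_false, if_true, if_false]
    simp_rw [this]
    rw [integral_indicator (measurableSet_truncDisc 0 R α), setIntegral_const, smul_eq_mul,
      mul_one]
    rfl
  rw [area, htrans, ← area, ← h2, h1, integral_Icc_eq_integral_Ioc,
    ← intervalIntegral.integral_of_le (by linarith), ← integral_two_sqrt hR hα]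
  refine intervalIntegral.integral_congr fun x hx => ?_
  rw [uIcc_of_le (by linarith)] at hx
  have hnn : 0 ≤ R ^ 2 - x ^ 2 := by nlinarith [hx.1, hx.2]
  set s := √(R ^ 2 - x ^ 2) with hs
  have hs2 : s ^ 2 = R ^ 2 - x ^ 2 := sq_sqrt hnn
  have hs0 : 0 ≤ s := sqrt_nonneg _
  have : ∀ y, D.indicator (fun _ => (1 : ℝ)) (x, y) = (Icc (-s) s).indicator (fun _ => 1) y := by
    intro y
    have : (x, y) ∈ D ↔ y ∈ Icc (-s) s := by
      rw [mem_Icc, ← abs_le, ← abs_of_nonneg hs0, ← sq_le_sq, hs2]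
      change x ^ 2 + y ^ 2 ≤ R ^ 2 ↔ _
      constructor <;> intro h <;> linarith
    by_cases h : y ∈ Icc (-s) s
    · rw [indicator_of_mem h, indicator_of_mem (this.2 h)]
    · rw [indicator_of_notMem h, indicator_of_notMem (mt this.1 h)]
  simp only [this]
  rw [integral_indicator measurableSet_Icc, setIntegral_const, measureReal_def, volume_Icc,
    ENNReal.toReal_ofReal (by linarith), smul_eq_mul]
  ring

/-- On the region the distance is `R` minus the cone, and the cone vanishes on the rest of the
strip. This is the equality case of `le_outbound`. -/
lemma outbound_truncDisc (c : Plane) {R α : ℝ} (hR : 0 < R) (hα : α ∈ Ico 0 (π / 2)) :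
    outbound (truncDisc c R α) c = R ^ 3 * unitArea α - coneStrip R (R * cos α) := by
  have hc := cos_pos_of_mem hα
  have hRc : 0 < R * cos α := by positivity
  have htrans : outbound (truncDisc c R α) c = ∫ p in truncDisc 0 R α, ‖p‖ := by
    have := (measurePreserving_sub_right volume c).setIntegral_preimage_emb
      (Homeomorph.subRight c).measurableEmbedding (fun p : Plane => ‖p‖) (truncDisc 0 R α)
    rw [preimage_sub_truncDisc] at this
    rw [outbound, ← this]
    simp only [dist_eq_norm]
  have hcone : ∫ p in truncDisc 0 R α, cone R ‖p‖ = coneStrip R (R * cos α) := by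
    have h1 := setIntegral_slices (integrable_cone_prod R) (Icc (-(R * cos α)) (R * cos α))
    rw [integral_Icc_eq_integral_Ioc, ← intervalIntegral.integral_of_le (by linarith)] at h1
    change _ = coneStrip R (R * cos α) at h1
    simp only [← norm_plane] at h1
    rw [← h1]
    refine (setIntegral_eq_of_subset_of_forall_sdiff_eq_zero
      (measurableSet_slab measurableSet_Icc) (fun p hp => ((mem_truncDisc_zero hR).1 hp).1)
      fun p hp => cone_of_ge ?_).symm
    by_contra hlt
    exact hp.2 ((mem_truncDisc_zero hR).2 ⟨hp.1, by
      rw [← norm_plane_sq]; exact pow_le_pow_left₀ (norm_nonneg p) (not_le.1 hlt).le 2⟩)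
  have hfin : IsFiniteMeasure (volume.restrict (truncDisc (0 : Plane) R α)) :=
    ⟨by simpa using volume_truncDisc_lt_top 0 R α⟩
  have hsub : ∫ p in truncDisc 0 R α, ‖p‖ =
      ∫ p in truncDisc 0 R α, (R - cone R ‖p‖) := by
    refine setIntegral_congr_fun (measurableSet_truncDisc 0 R α) fun p hp => ?_
    have : ‖p‖ ≤ R := by simpa using hp.1
    simp only [cone_of_le this]
    ring
  rw [htrans, hsub, integral_sub (integrable_const R) (integrable_cone_norm R).integrableOn, hcone,
    setIntegral_const, smul_eq_mul, measureReal_def, ← area, area_truncDisc 0 hR hα]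
  ring

/-! ### Voronoi cells -/

lemma volume_bisector {a b : Plane} (h : a ≠ b) : volume {p : Plane | dist p a = dist p b} = 0 := by
  have e : {p : Plane | dist p a = dist p b} = AffineSubspace.perpBisector a b := by
    ext p; exact AffineSubspace.mem_perpBisector_iff_dist_eq.symm
  rw [e]
  exact Measure.addHaar_affineSubspace _ _ (mt AffineSubspace.perpBisector_eq_top.1 h)

lemma voronoiCell_inter_subset (x : ℕ → Plane) (i j : ℕ) :
    voronoiCell x i ∩ voronoiCell x j ⊆ {p | dist p (x i) = dist p (x j)} :=
  fun _ hp => le_antisymm (hp.1 j) (hp.2 i)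

lemma isClosed_voronoiCell (x : ℕ → Plane) (i : ℕ) : IsClosed (voronoiCell x i) := by
  have : voronoiCell x i = ⋂ j, {p | dist p (x i) ≤ dist p (x j)} := by
    ext p; simp [voronoiCell]
  rw [this]
  exact isClosed_iInter fun j => isClosed_le (by fun_prop) (by fun_prop)

/-- A limit point of the facilities has a nearest facility, which must then be at distance 0. -/
lemma isClosed_range_of_cover {x : ℕ → Plane} (h : (⋃ i, voronoiCell x i) = univ) :
    IsClosed (range x) := by
  refine isClosed_of_closure_subset fun q hq => ?_
  obtain ⟨i, hi⟩ := mem_iUnion.1 (h.symm ▸ mem_univ q)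
  refine ⟨i, (dist_le_zero.1 ?_).symm⟩
  refine le_of_forall_pos_le_add fun ε hε => ?_
  obtain ⟨_, ⟨j, rfl⟩, hj⟩ := Metric.mem_closure_iff.1 hq ε hε
  linarith [hi j]

lemma dist_le_dist_iff_inner (p a b : Plane) :
    dist p a ≤ dist p b ↔ 2 * inner ℝ (p - a) (b - a) ≤ ‖b - a‖ ^ 2 := by
  have e : p - b = (p - a) - (b - a) := by abel
  rw [dist_eq_norm, dist_eq_norm, ← sq_le_sq₀ (norm_nonneg _) (norm_nonneg _), e,
    norm_sub_sq_real (p - a)]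
  constructor <;> intro h <;> linarith

/-- A ball inside the cell keeps its centre away from the bisectors. -/
lemma inner_le_of_ball_subset {x : ℕ → Plane} {i : ℕ} {m : Plane} {ε : ℝ} (hε : 0 < ε)
    (h : Metric.ball m ε ⊆ voronoiCell x i) (j : ℕ) :
    2 * inner ℝ (m - x i) (x j - x i) ≤ ‖x j - x i‖ ^ 2 - ε * ‖x j - x i‖ := by
  set v := x j - x i with hv
  rcases eq_or_ne v 0 with h0 | h0
  · simp [h0]
  have hn : 0 < ‖v‖ := norm_pos_iff.2 h0
  have hp : m + (ε / (2 * ‖v‖)) • v ∈ Metric.ball m ε := by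
    rw [mem_ball_iff_norm, add_sub_cancel_left, norm_smul, norm_eq_abs, abs_of_pos (by positivity)]
    have : ε / (2 * ‖v‖) * ‖v‖ = ε / 2 := by field_simp
    linarith
  have := (dist_le_dist_iff_inner _ _ _).1 (h hp j)
  rw [← hv, add_sub_right_comm, inner_add_left, inner_smul_left, real_inner_self_eq_norm_sq] at this
  have e : (ε / (2 * ‖v‖)) * ‖v‖ ^ 2 = ε / 2 * ‖v‖ := by field_simp
  simp only [conj_trivial] at this
  linarith

/-- The margin in `inner_le_of_ball_subset` is strict for `x j ≠ x i`, so an interior point avoids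
the bisector. -/
lemma dist_lt_of_mem_interior {x : ℕ → Plane} {i j : ℕ} (hij : x j ≠ x i) {m : Plane}
    (hm : m ∈ interior (voronoiCell x i)) : dist m (x i) ≠ dist m (x j) := by
  obtain ⟨ε, hε, hb⟩ := Metric.mem_nhds_iff.1 (mem_interior_iff_mem_nhds.1 hm)
  have h1 := inner_le_of_ball_subset hε hb j
  have hn : 0 < ‖x j - x i‖ := norm_pos_iff.2 (sub_ne_zero.2 hij)
  intro he
  have h2 := (dist_le_dist_iff_inner m (x j) (x i)).1 he.symm.le
  have e : m - x j = (m - x i) - (x j - x i) := by abel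
  rw [e, ← neg_sub (x j) (x i), inner_neg_right, inner_sub_left, real_inner_self_eq_norm_sq,
    norm_neg] at h2
  nlinarith [mul_pos hε hn]

lemma mem_voronoiCell_self (x : ℕ → Plane) (i : ℕ) : x i ∈ voronoiCell x i := fun j => by
  rw [dist_self]; exact dist_nonneg

/-! ### Exposed points distinguish Voronoi cells from truncated discs -/

/-- The strictly exposed boundary points of a region. -/
def exposedPoints (V : Set Plane) : Set Plane :=
  {q | q ∈ V ∧ q ∉ interior V ∧ ∀ s ∈ V, s ≠ q → midpoint ℝ s q ∈ interior V}

/-- Were `q` on no bisector, it would be interior. Facilities within `ε` of `x i` are handled by the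
ball about the midpoint of `x i` and `q`; the remaining ones form a closed set, whose distance from
`q` is attained and so exceeds `dist q (x i)` by a fixed gap `g`. -/
lemma exists_dist_eq_of_exposed {x : ℕ → Plane} (hcl : IsClosed (range x)) {i : ℕ} {q : Plane}
    (hq : q ∈ exposedPoints (voronoiCell x i)) (hne : q ≠ x i) :
    ∃ j, x j ≠ x i ∧ dist q (x i) = dist q (x j) := by
  obtain ⟨hqV, hqi, hmid⟩ := hq
  obtain ⟨ε, hε, hb⟩ := Metric.mem_nhds_iff.1
    (mem_interior_iff_mem_nhds.1 (hmid _ (mem_voronoiCell_self x i) hne.symm))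
  by_contra! hcon
  have hm : ∀ j, inner ℝ (q - x i) (x j - x i) ≤ ‖x j - x i‖ ^ 2 - ε * ‖x j - x i‖ := by
    intro j
    have h := inner_le_of_ball_subset hε hb j
    have e : midpoint ℝ (x i) q - x i = (1 / 2 : ℝ) • (q - x i) := by
      rw [midpoint_sub_left]; simp
    rw [e, inner_smul_left] at h
    simp only [conj_trivial] at h
    linarith
  set F := range x \ Metric.ball (x i) ε with hF
  have hFcl : IsClosed F := hcl.sdiff Metric.isOpen_ball
  obtain ⟨g, hg, hgF⟩ : ∃ g > 0, ∀ y ∈ F, dist q (x i) + g ≤ dist q y := by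
    rcases F.eq_empty_or_nonempty with h0 | h0
    · exact ⟨1, one_pos, fun y hy => by simp [h0] at hy⟩
    · obtain ⟨y, hy, hmin⟩ := hFcl.exists_infDist_eq_dist h0 q
      obtain ⟨⟨j, rfl⟩, hjb⟩ := hy
      have hji : x j ≠ x i := fun h => hjb (by rw [h]; exact Metric.mem_ball_self hε)
      have hlt : dist q (x i) < dist q (x j) := lt_of_le_of_ne (hqV j) (hcon j hji)
      refine ⟨dist q (x j) - dist q (x i), by linarith, fun y hy => ?_⟩
      have := Metric.infDist_le_dist_of_mem (x := q) hy
      linarith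
  refine hqi (mem_interior_iff_mem_nhds.2 (Metric.mem_nhds_iff.2
    ⟨min (ε / 2) (g / 2), by positivity, fun p hp j => ?_⟩))
  rw [Metric.mem_ball, lt_min_iff] at hp
  by_cases hj : x j ∈ Metric.ball (x i) ε
  · rw [dist_le_dist_iff_inner]
    rw [mem_ball_iff_norm] at hj
    have e : p - x i = (q - x i) + (p - q) := by abel
    rw [e, inner_add_left]
    have h1 := real_inner_le_norm (p - q) (x j - x i)
    have h2 := hm j
    have h3 : ‖p - q‖ ≤ ε / 2 := by rw [← dist_eq_norm]; exact hp.1.le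
    nlinarith [mul_le_mul_of_nonneg_right h3 (norm_nonneg (x j - x i)),
      mul_le_mul_of_nonneg_right hj.le (norm_nonneg (x j - x i))]
  · have h1 := hgF (x j) ⟨mem_range_self j, hj⟩
    have h2 := dist_triangle p q (x i)
    have h3 := dist_triangle q p (x j)
    rw [dist_comm q p] at h3
    linarith [hp.2]

/-- Sending an exposed point to the index of a bisector through it is injective: the midpoint of two
points on one bisector lies on it, but is interior by exposedness. -/
lemma countable_exposedPoints {x : ℕ → Plane} (hcl : IsClosed (range x)) (i : ℕ) :
    (exposedPoints (voronoiCell x i)).Countable := by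
  have h : ∀ q : Plane, ∃ j, q ∈ exposedPoints (voronoiCell x i) \ {x i} →
      x j ≠ x i ∧ dist q (x i) = dist q (x j) := by
    intro q
    by_cases hq : q ∈ exposedPoints (voronoiCell x i) \ {x i}
    · obtain ⟨j, hj⟩ := exists_dist_eq_of_exposed hcl hq.1 hq.2
      exact ⟨j, fun _ => hj⟩
    · exact ⟨0, fun h => absurd h hq⟩
  choose k hk using h
  have hinj : InjOn k (exposedPoints (voronoiCell x i) \ {x i}) := by
    intro q hq q' hq' he
    by_contra hne
    have hm := hq'.1.2.2 q hq.1.1 hne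
    refine dist_lt_of_mem_interior (hk q hq).1 hm ?_
    have h1 : q ∈ AffineSubspace.perpBisector (x i) (x (k q)) :=
      AffineSubspace.mem_perpBisector_iff_dist_eq.2 (hk q hq).2
    have h2 : q' ∈ AffineSubspace.perpBisector (x i) (x (k q)) :=
      AffineSubspace.mem_perpBisector_iff_dist_eq.2 (he ▸ (hk q' hq').2)
    exact AffineSubspace.mem_perpBisector_iff_dist_eq.1
      (AffineMap.lineMap_mem (2⁻¹ : ℝ) h1 h2)
  have hc : (exposedPoints (voronoiCell x i) \ {x i}).Countable :=
    (mapsTo_univ k _).countable_of_injOn hinj countable_univ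
  exact (hc.insert (x i)).mono (by simp)

/-- Isometries preserve midpoints by the Mazur–Ulam theorem, and interiors as homeomorphisms. -/
lemma image_exposedPoints (φ : Plane ≃ᵢ Plane) (V : Set Plane) :
    φ '' exposedPoints V ⊆ exposedPoints (φ '' V) := by
  have hint : interior (φ '' V) = φ '' interior V := (φ.toHomeomorph.image_interior V).symm
  rintro _ ⟨q, ⟨hq, hqi, hmid⟩, rfl⟩
  refine ⟨mem_image_of_mem φ hq, ?_, ?_⟩
  · rw [hint, φ.injective.mem_set_image]
    exact hqi
  · rintro _ ⟨s, hs, rfl⟩ hne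
    rw [hint, ← φ.map_midpoint, φ.injective.mem_set_image]
    exact hmid s hs (fun h => hne (h ▸ rfl))

/-- Every point of an open circular arc is exposed: a midpoint with another point of the region is
strictly inside the disc by the parallelogram law, and strictly inside the strip because `|cos θ| <
cos α`. -/
lemma not_countable_exposedPoints_truncDisc (c : Plane) {R α : ℝ} (hR : 0 < R)
    (hα : α ∈ Ico 0 (π / 2)) : ¬ (exposedPoints (truncDisc c R α)).Countable := by
  intro hcount
  have hmaps : MapsTo (fun θ => c + R • dir θ) (Ioo α (π - α))
      (exposedPoints (truncDisc c R α)) := by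
    intro θ hθ
    have hcos : |cos θ| < cos α := by
      rw [abs_lt, ← cos_pi_sub]
      exact ⟨cos_lt_cos_of_nonneg_of_le_pi (by linarith [hα.1, hθ.1]) (by linarith [hα.1]) hθ.2,
        cos_lt_cos_of_nonneg_of_le_pi hα.1 (by linarith [hθ.2, hα.1]) hθ.1⟩
    refine ⟨add_smul_dir_mem ⟨hR.le, le_rfl⟩ hcos.le, ?_, ?_⟩
    · intro h
      have hsub : truncDisc c R α ⊆ Metric.closedBall c R := fun p hp => by
        rw [Metric.mem_closedBall, dist_eq_norm]; exact hp.1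
      have := interior_mono hsub h
      rw [interior_closedBall c hR.ne', mem_ball_iff_norm, add_sub_cancel_left, norm_smul,
        norm_dir, mul_one, norm_eq_abs, abs_of_pos hR] at this
      exact lt_irrefl _ this
    · intro s hs hne
      have hopen₁ : IsOpen {p : Plane | ‖p - c‖ < R} := isOpen_lt (by fun_prop) continuous_const
      have hopen₂ : IsOpen {p : Plane | |p 0 - c 0| < R * cos α} :=
        isOpen_lt (by fun_prop) continuous_const
      refine interior_maximal (s := truncDisc c R α)
        (fun p (hp : ‖p - c‖ < R ∧ |p 0 - c 0| < R * cos α) => ⟨hp.1.le, hp.2.le⟩)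
        (hopen₁.inter hopen₂) ?_
      set q := c + R • dir θ with hq
      have e : midpoint ℝ s q - c = (1 / 2 : ℝ) • ((s - c) + (q - c)) := by
        rw [midpoint_eq_smul_add, invOf_eq_inv]
        module
      have hqn : ‖q - c‖ = R := by
        rw [hq, add_sub_cancel_left, norm_smul, norm_dir, mul_one, norm_eq_abs, abs_of_pos hR]
      change ‖midpoint ℝ s q - c‖ < R ∧ |(midpoint ℝ s q) 0 - c 0| < R * cos α
      constructor
      · have hpar := parallelogram_law_with_norm ℝ (s - c) (q - c)
        have hpos : 0 < ‖(s - c) - (q - c)‖ := by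
          rw [sub_sub_sub_cancel_right]; exact norm_pos_iff.2 (sub_ne_zero.2 hne)
        rw [e, norm_smul, norm_eq_abs, abs_of_pos (by norm_num)]
        have hsn : ‖s - c‖ ≤ R := hs.1
        rw [hqn] at hpar
        have h0 := norm_nonneg (s - c + (q - c))
        nlinarith [norm_nonneg (s - c), mul_pos hpos hpos]
      · have e0 : (midpoint ℝ s q) 0 - c 0 = 1 / 2 * ((s 0 - c 0) + R * cos θ) := by
          have := congrArg (fun p : Plane => p 0) e
          simpa [hq, dir_zero, mul_add] using this
        have h1 := abs_le.1 hs.2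
        have h2 := abs_lt.1 hcos
        rw [e0, abs_lt]
        constructor <;> nlinarith
  have hinj : InjOn (fun θ => c + R • dir θ) (Ioo α (π - α)) := by
    intro θ hθ θ' hθ' he
    have h := congrArg (fun p : Plane => p 0) he
    have h' : cos θ = cos θ' := by simpa [dir_zero, hR.ne'] using h
    exact injOn_cos ⟨by linarith [hα.1, hθ.1], by linarith [hα.1, hθ.2]⟩
      ⟨by linarith [hα.1, hθ'.1], by linarith [hα.1, hθ'.2]⟩ h'
  have := hmaps.countable_of_injOn hinj hcount
  linarith [Cardinal.Real.Ioo_countable_iff.1 this, hα.2]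

lemma voronoiCell_ne_image_truncDisc {x : ℕ → Plane} (hx : IsFeasibleLayout x) (i : ℕ)
    (φ : Plane ≃ᵢ Plane) (c : Plane) {R α : ℝ} (hR : 0 < R) (hα : α ∈ Ico 0 (π / 2)) :
    voronoiCell x i ≠ φ '' truncDisc c R α := by
  intro h
  have h1 := countable_exposedPoints (isClosed_range_of_cover hx.cover) i
  rw [h] at h1
  have h2 := h1.mono (image_exposedPoints φ _)
  exact not_countable_exposedPoints_truncDisc c hR hα
    (countable_of_injective_of_countable_image φ.injective.injOn h2)

/-! ### The lower bound -/

/-- Telescoping with the negative increments dropped; the right side no longer depends on `i`, so it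
dominates the maximum. -/
lemma le_add_sum_max_sub (w : ℕ → ℝ) {N i : ℕ} (hi : i ∈ Finset.Icc 1 N) :
    w i ≤ w 1 + ∑ k ∈ Finset.Ico 1 N, max (w (k + 1) - w k) 0 := by
  rw [Finset.mem_Icc] at hi
  have h1 : w i ≤ w 1 + ∑ k ∈ Finset.Ico 1 i, max (w (k + 1) - w k) 0 := by
    obtain ⟨hi1, -⟩ := hi
    induction i, hi1 using Nat.le_induction with
    | base => simp
    | succ n hn ih =>
      rw [Finset.sum_Ico_succ_top hn]
      linarith [le_max_left (w (n + 1) - w n) 0]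
  refine h1.trans (add_le_add_right (Finset.sum_le_sum_of_subset_of_nonneg
    (Finset.Ico_subset_Ico_right hi.2) fun _ _ _ => le_max_right _ _) _)

lemma integrable_cone_sub (R : ℝ) (a b : Plane) :
    Integrable fun p => max (cone R (dist p a) - cone R (dist p b)) 0 :=
  ((integrable_cone_dist R a).sub (integrable_cone_dist R b)).pos_part

/-- Adding the facilities one by one along the tour bounds the integral of the upper envelope of
the cones. -/
lemma sum_setIntegral_cone_le (R : ℝ) {N : ℕ} (y : ℕ → Plane) (S : ℕ → Set Plane)
    (hS : ∀ i, MeasurableSet (S i))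
    (hd : ∀ i ∈ Finset.Icc 1 N, ∀ j ∈ Finset.Icc 1 N, i ≠ j → volume (S i ∩ S j) = 0) :
    ∑ i ∈ Finset.Icc 1 N, ∫ p in S i, cone R (dist p (y i)) ≤
      (∫ p : Plane, cone R ‖p‖) +
        ∑ k ∈ Finset.Ico 1 N, coneStrip R (dist (y k) (y (k + 1)) / 2) := by
  set M : Plane → ℝ := fun p => cone R (dist p (y 1)) +
    ∑ k ∈ Finset.Ico 1 N, max (cone R (dist p (y (k + 1))) - cone R (dist p (y k))) 0 with hM
  have hint1 := integrable_cone_dist R (y 1)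
  have hint2 : Integrable fun p => ∑ k ∈ Finset.Ico 1 N,
      max (cone R (dist p (y (k + 1))) - cone R (dist p (y k))) 0 :=
    integrable_finsetSum _ fun k _ => integrable_cone_sub R _ _
  have hMi : Integrable M := hint1.add hint2
  have hM0 : ∀ p, 0 ≤ M p := fun p =>
    add_nonneg (cone_nonneg _ _) (Finset.sum_nonneg fun _ _ => le_max_right _ _)
  have h1 : ∑ i ∈ Finset.Icc 1 N, ∫ p in S i, cone R (dist p (y i)) ≤
      ∑ i ∈ Finset.Icc 1 N, ∫ p in S i, M p := by
    refine Finset.sum_le_sum fun i hi => ?_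
    exact setIntegral_mono (integrable_cone_dist R (y i)).integrableOn hMi.integrableOn
      fun p => le_add_sum_max_sub (fun k => cone R (dist p (y k))) hi
  have h2 : ∑ i ∈ Finset.Icc 1 N, ∫ p in S i, M p =
      ∫ p in ⋃ i : Finset.Icc 1 N, S i, M p := by
    rw [integral_iUnion_ae (s := fun i : Finset.Icc 1 N => S i)
      (fun i => (hS i).nullMeasurableSet) ?_ hMi.integrableOn, tsum_fintype,
      Finset.sum_coe_sort (Finset.Icc 1 N) fun i => ∫ p in S i, M p]
    intro i j hij
    exact hd i i.2 j j.2 fun h => hij (Subtype.ext h)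
  have h3 : ∫ p in ⋃ i : Finset.Icc 1 N, S i, M p ≤ ∫ p, M p :=
    setIntegral_le_integral hMi (Eventually.of_forall hM0)
  have h4 : ∫ p, M p = (∫ p : Plane, cone R ‖p‖) +
        ∑ k ∈ Finset.Ico 1 N, coneStrip R (dist (y k) (y (k + 1)) / 2) := by
    rw [hM, integral_add hint1 hint2, integral_cone_dist,
      integral_finsetSum _ fun k _ => integrable_cone_sub R _ _]
    simp only [integral_cone_sub, dist_comm]
  linarith

lemma le_outbound {S : Set Plane} (hS : IsCompact S) (R : ℝ) (c : Plane) :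
    R * area S - ∫ p in S, cone R (dist p c) ≤ outbound S c := by
  have hfin : IsFiniteMeasure (volume.restrict S) := ⟨by simpa using hS.measure_lt_top⟩
  have h1 : ∫ p in S, (R - cone R (dist p c)) ≤ outbound S c := by
    refine setIntegral_mono ((integrable_const R).sub (integrable_cone_dist R c).integrableOn)
      (Continuous.continuousOn (by fun_prop) |>.integrableOn_compact hS) fun p => ?_
    have := le_max_left (R - dist p c) 0
    simp only [cone]
    linarith
  rw [integral_sub (integrable_const R) (integrable_cone_dist R c).integrableOn,
    setIntegral_const, smul_eq_mul, measureReal_def, ← area] at h1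
  linarith

/-- Each inner leg is charged by halves to its two ends. The legs from `y 0` and to `y (N + 1)` are
dropped, so these points are irrelevant. -/
lemma sum_dist_le_sum_inboundLength (y : ℕ → Plane) (N : ℕ) :
    ∑ k ∈ Finset.Ico 1 N, dist (y k) (y (k + 1)) ≤ ∑ i ∈ Finset.Icc 1 N, inboundLength y i := by
  have h1 : ∑ k ∈ Finset.Ico 1 N, dist (y k) (y (k + 1)) ≤
      ∑ i ∈ Finset.Icc 1 N, dist (y i) (y (i - 1)) := by
    have := Finset.sum_Ico_add' (fun i => dist (y i) (y (i - 1))) 1 N 1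
    simp only [add_tsub_cancel_right] at this
    simp only [dist_comm (y _) (y (_ + 1))]
    rw [this]
    refine Finset.sum_le_sum_of_subset_of_nonneg (fun i hi => ?_) fun _ _ _ => dist_nonneg
    rw [Finset.mem_Ico] at hi
    rw [Finset.mem_Icc]
    omega
  have h2 : ∑ k ∈ Finset.Ico 1 N, dist (y k) (y (k + 1)) ≤
      ∑ i ∈ Finset.Icc 1 N, dist (y i) (y (i + 1)) :=
    Finset.sum_le_sum_of_subset_of_nonneg Finset.Ico_subset_Icc_self fun _ _ _ => dist_nonneg
  simp only [inboundLength]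
  rw [← Finset.sum_div, Finset.sum_add_distrib]
  linarith

/-- The root equation of `alphaInf r`, read as a first-order condition on the strip width. -/
lemma coneSlice_alphaInf {R r : ℝ} (hR : 0 < R) (hr : 0 ≤ r) :
    coneSlice R (R * cos (alphaInf r)) = r * (R ^ 2 * unitArea (alphaInf r)) := by
  obtain ⟨hm, h0⟩ := alphaInf_spec hr
  rw [coneSlice_cos hR hm]
  unfold reducedHInf at h0
  linear_combination R ^ 2 * h0

/-- The outbound and inbound travel of the idealized region. -/
lemma travel_alphaInf {R r : ℝ} (hR : 0 < R) (hr : 0 ≤ r) :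
    R ^ 3 * unitArea (alphaInf r) - coneStrip R (R * cos (alphaInf r))
      + r * (R ^ 2 * unitArea (alphaInf r)) * (2 * (R * cos (alphaInf r))) =
      (R * √(unitArea (alphaInf r))) ^ 3 / gInf r := by
  obtain ⟨hm, h0⟩ := alphaInf_spec hr
  have hU := unitArea_pos hm
  have hc := cos_pos_of_mem hm
  rw [coneStrip_cos hR hm, gInf_eq hr]
  set a := alphaInf r
  have hs2 : √(unitArea a) ^ 2 = unitArea a := sq_sqrt hU.le
  have hs := sqrt_pos.2 hU
  have e : (R * √(unitArea a)) ^ 3 / (3 * √(unitArea a) / (2 + 4 * r * cos a)) =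
      R ^ 3 * (√(unitArea a) ^ 2) * (2 + 4 * r * cos a) / 3 := by
    field_simp
  rw [e, hs2]
  have hUe : unitArea a = 2 * sin a * cos a + (π - 2 * a) := by rw [unitArea, sin_two_mul]
  unfold reducedHInf at h0
  linear_combination (-2 / 3 * R ^ 3 * cos a) * h0 + (R ^ 3 / 3) * hUe

lemma lower_bound_travel {r : ℝ} (hr : 0 ≤ r) {N : ℕ} (y : ℕ → Plane)
    (S : ℕ → Set Plane) (hS : ∀ i, IsCompact (S i))
    (hd : ∀ i ∈ Finset.Icc 1 N, ∀ j ∈ Finset.Icc 1 N, i ≠ j → volume (S i ∩ S j) = 0)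
    {u : ℝ} (hu : 0 < u) (hA : ∑ i ∈ Finset.Icc 1 N, area (S i) = N * u ^ 2) :
    N * (u ^ 3 / gInf r) - π * (u / √(unitArea (alphaInf r))) ^ 3 ≤
      ∑ i ∈ Finset.Icc 1 N, outbound (S i) (y i) +
        r * u ^ 2 * ∑ i ∈ Finset.Icc 1 N, inboundLength y i := by
  have hm := (alphaInf_spec hr).1
  have hU := unitArea_pos hm
  have hs := sqrt_pos.2 hU
  have hc := cos_pos_of_mem hm
  -- Chosen so that the truncated disc of radius `R` has the mean area `u²`.
  set R := u / √(unitArea (alphaInf r)) with hRdef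
  have hR : 0 < R := by positivity
  have hRu : R * √(unitArea (alphaInf r)) = u := div_mul_cancel₀ _ hs.ne'
  have hRA : R ^ 2 * unitArea (alphaInf r) = u ^ 2 := by
    rw [← hRu, mul_pow, sq_sqrt hU.le]
  have htr := travel_alphaInf hR hr
  have hsl := coneSlice_alphaInf hR hr
  rw [hRA] at hsl
  rw [hRu, hRA] at htr
  set h₀ := R * cos (alphaInf r) with hh₀
  have hh₀0 : 0 ≤ h₀ := by positivity
  set m := coneStrip R h₀ - 2 * (r * u ^ 2) * h₀ with hmdef
  -- The tangent at `h₀`; its slope in `d` is the inbound price `r u²`.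
  have hstep : ∀ d, 0 ≤ d → coneStrip R (d / 2) ≤ m + r * u ^ 2 * d := fun d hd => by
    have := coneStrip_le R hh₀0 (by linarith : 0 ≤ d / 2)
    rw [hsl] at this
    linarith
  have hm0 : 0 ≤ m := by
    have h := hstep 0 le_rfl
    simpa [coneStrip] using h
  have h1 : ∑ i ∈ Finset.Icc 1 N, (R * area (S i) - ∫ p in S i, cone R (dist p (y i))) ≤
      ∑ i ∈ Finset.Icc 1 N, outbound (S i) (y i) :=
    Finset.sum_le_sum fun i _ => le_outbound (hS i) R (y i)
  rw [Finset.sum_sub_distrib, ← Finset.mul_sum, hA] at h1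
  have h2 := sum_setIntegral_cone_le R y S (fun i => (hS i).measurableSet) hd
  have h3 : ∑ k ∈ Finset.Ico 1 N, coneStrip R (dist (y k) (y (k + 1)) / 2) ≤
      N * m + r * u ^ 2 * ∑ k ∈ Finset.Ico 1 N, dist (y k) (y (k + 1)) := by
    refine (Finset.sum_le_sum fun k _ => hstep _ dist_nonneg).trans ?_
    rw [Finset.sum_add_distrib, ← Finset.mul_sum, Finset.sum_const, Nat.card_Ico, nsmul_eq_mul]
    -- There are only `N - 1` inner legs; `m ≥ 0`, the tangent bound at `d = 0`, allows `N`.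
    have : ((N - 1 : ℕ) : ℝ) * m ≤ N * m := by
      gcongr
      exact Nat.sub_le N 1
    linarith
  have h4 := mul_le_mul_of_nonneg_left (sum_dist_le_sum_inboundLength y N)
    (mul_nonneg hr (sq_nonneg u))
  have h5 := integral_cone_le hR.le
  have h6 : R ^ 3 * unitArea (alphaInf r) = R * u ^ 2 := by rw [← hRA]; ring
  rw [h6] at htr
  have h7 : u ^ 3 / gInf r = R * u ^ 2 - m := by rw [← htr, hmdef]; ring
  rw [h7]
  linarith

/-! ### Optimisation over the mean area -/

lemma averageCost_eq {f κ r : ℝ} {N : ℕ} (hN : 1 ≤ N) (y : ℕ → Plane) (S : ℕ → Set Plane)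
    {u : ℝ} (hu : 0 < u) (hA : ∑ i ∈ Finset.Icc 1 N, area (S i) = N * u ^ 2) :
    averageCost f κ r N y S = f / u ^ 2 + κ * f / (N * u ^ 2) *
      (∑ i ∈ Finset.Icc 1 N, outbound (S i) (y i) +
        r * u ^ 2 * ∑ i ∈ Finset.Icc 1 N, inboundLength y i) := by
  have hN' : (0 : ℝ) < N := by exact_mod_cast hN
  rw [averageCost, hA, Finset.sum_add_distrib, ← Finset.mul_sum]
  simp only [Finset.sum_const, Nat.card_Icc, add_tsub_cancel_right, nsmul_eq_mul, mul_one]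
  field_simp
  ring

/-- The AM-GM inequality for `1 / u²`, `m³ u`, `m³ u`, with equality at `m u = 1`. -/
lemma three_mul_sq_le {u m : ℝ} (hu : 0 < u) (hm : 0 ≤ m) : 3 * m ^ 2 ≤ 1 / u ^ 2 + 2 * m ^ 3 * u := by
  have h : 1 / u ^ 2 + 2 * m ^ 3 * u - 3 * m ^ 2 = (m * u - 1) ^ 2 * (2 * (m * u) + 1) / u ^ 2 := by
    field_simp
    ring
  have : 0 ≤ (m * u - 1) ^ 2 * (2 * (m * u) + 1) / u ^ 2 := by positivity
  linarith

/-- The loss from the initial cone is a multiple of `u³`, like the main term, so both merge into the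
coefficient `2 m³` and nothing need be known about the mean area. -/
lemma le_averageCost {f κ r : ℝ} (hf : 0 < f) (hκ : 0 < κ) (hr : 0 ≤ r) {N : ℕ} (hN : 1 ≤ N)
    (y : ℕ → Plane) (S : ℕ → Set Plane) (hS : ∀ i, IsCompact (S i))
    (hSa : ∀ i, 0 < area (S i))
    (hd : ∀ i ∈ Finset.Icc 1 N, ∀ j ∈ Finset.Icc 1 N, i ≠ j → volume (S i ∩ S j) = 0)
    {m : ℝ} (hm : 0 ≤ m)
    (hm3 : 2 * m ^ 3 = κ * (1 / gInf r - π / √(unitArea (alphaInf r)) ^ 3 / N)) :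
    3 * f * m ^ 2 ≤ averageCost f κ r N y S := by
  have hN' : (0 : ℝ) < N := by exact_mod_cast hN
  have hsum : 0 < ∑ i ∈ Finset.Icc 1 N, area (S i) :=
    Finset.sum_pos (fun i _ => hSa i) (Finset.nonempty_Icc.2 hN)
  set u := √((∑ i ∈ Finset.Icc 1 N, area (S i)) / N) with hudef
  have hu : 0 < u := sqrt_pos.2 (by positivity)
  have hA : ∑ i ∈ Finset.Icc 1 N, area (S i) = N * u ^ 2 := by
    rw [hudef, sq_sqrt (by positivity), mul_div_cancel₀ _ hN'.ne']
  have hU := sqrt_pos.2 (unitArea_pos (alphaInf_spec hr).1)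
  have hg := gInf_pos hr
  rw [averageCost_eq hN y S hu hA]
  have h1 := mul_le_mul_of_nonneg_left (lower_bound_travel hr y S hS hd hu hA)
    (by positivity : 0 ≤ κ * f / (N * u ^ 2))
  have h2 := mul_le_mul_of_nonneg_left (three_mul_sq_le hu hm) hf.le
  rw [hm3] at h2
  have e : κ * f / (N * u ^ 2) * (N * (u ^ 3 / gInf r) - π * (u / √(unitArea (alphaInf r))) ^ 3) =
      f * (κ * (1 / gInf r - π / √(unitArea (alphaInf r)) ^ 3 / N) * u) := by
    field_simp
  have e2 : f / u ^ 2 = f * (1 / u ^ 2) := by ring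
  rw [e] at h1
  rw [e2]
  linarith

lemma costBound_eq {f κ r q : ℝ} (hf : 0 < f) (hκ : 0 < κ) (hr : 0 ≤ r) (hq : 0 < q)
    (hq3 : q ^ 3 = 2 * gInf r / κ) : costBound f κ r = 3 * f / q ^ 2 := by
  have hg := gInf_pos hr
  have hg' : gInf r = κ * q ^ 3 / 2 := by rw [hq3]; field_simp
  have e : κ ^ 2 * f ^ 3 / (4 * gInf r ^ 2) = (f / q ^ 2) ^ (3 : ℝ) := by
    rw [hg', show (3 : ℝ) = ((3 : ℕ) : ℝ) by norm_num, rpow_natCast]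
    field_simp
    norm_num
  rw [costBound, e, ← rpow_mul (by positivity)]
  norm_num
  ring

lemma costBound_le_optimalCost {f κ r : ℝ} (hf : 0 < f) (hκ : 0 < κ) (hr : 0 ≤ r) :
    (costBound f κ r : EReal) ≤ optimalCost f κ r := by
  refine le_iInf fun x => le_iInf fun t => le_iInf fun hx => le_iInf fun ht => ?_
  have hg := gInf_pos hr
  set C := π / √(unitArea (alphaInf r)) ^ 3
  -- The value of `m³` in `le_averageCost`; it is positive for large `N`, so its real cube root can
  -- be used.
  set b : ℕ → ℝ := fun N => κ / 2 * (1 / gInf r - C / N) with hb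
  have hblim : Tendsto b atTop (𝓝 (κ / 2 * (1 / gInf r))) := by
    have h := ((tendsto_const_nhds.div_atTop tendsto_natCast_atTop_atTop :
      Tendsto (fun N : ℕ => C / N) atTop (𝓝 0)).const_sub (1 / gInf r)).const_mul (κ / 2)
    rwa [sub_zero] at h
  have hpos : 0 < κ / 2 * (1 / gInf r) := by positivity
  have hcube : ∀ z : ℝ, 0 ≤ z → (z ^ (1 / 3 : ℝ)) ^ 3 = z := fun z hz => by
    rw [← rpow_natCast, ← rpow_mul hz]; norm_num
  have hlim : Tendsto (fun N => 3 * f * (b N ^ (1 / 3 : ℝ)) ^ 2) atTop (𝓝 (costBound f κ r)) := by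
    have h := (((hblim.rpow_const (p := 1 / 3) (Or.inl hpos.ne')).pow 2).const_mul (3 * f))
    have hq : 0 < (κ / 2 * (1 / gInf r)) ^ (1 / 3 : ℝ) := rpow_pos_of_pos hpos _
    rw [costBound_eq hf hκ hr (inv_pos.2 hq)]
    · convert h using 2
      rw [inv_pow, div_inv_eq_mul]
    · rw [inv_pow, hcube _ hpos.le]
      field_simp
  have hlim' : Tendsto (fun N => ((3 * f * (b N ^ (1 / 3 : ℝ)) ^ 2 : ℝ) : EReal)) atTop
      (𝓝 (costBound f κ r : EReal)) :=
    (continuous_coe_real_ereal.tendsto _).comp hlim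
  rw [← hlim'.liminf_eq]
  refine liminf_le_liminf ?_
  filter_upwards [eventually_ge_atTop 1, hblim.eventually (lt_mem_nhds hpos)] with N hN hbN
  have hcompact : ∀ i, IsCompact (voronoiCell x i) := fun i =>
    Metric.isCompact_of_isClosed_isBounded (isClosed_voronoiCell x i) (hx.bounded i)
  refine EReal.coe_le_coe_iff.2 (le_averageCost hf hκ hr hN _ _ (fun i => hcompact _) ?_ ?_
    (rpow_nonneg hbN.le _) ?_)
  · intro i
    refine ENNReal.toReal_pos ?_ (hcompact _).measure_lt_top.ne
    exact (Measure.measure_pos_of_nonempty_interior volume (hx.nondegenerate _)).ne'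
  · intro i hi j hj hij
    refine measure_mono_null (voronoiCell_inter_subset x _ _) (volume_bisector fun h => hij ?_)
    exact ht N (Finset.mem_Icc.1 hi) (Finset.mem_Icc.1 hj) (hx.injective h)
  · rw [hcube _ hbN.le, hb]
    ring

/-! ### The idealized straight-line arrangement -/

lemma lineSite_zero (R α : ℝ) (k : ℕ) : lineSite R α k 0 = 2 * R * cos α * k := rfl

lemma lineSite_one (R α : ℝ) (k : ℕ) : lineSite R α k 1 = 0 := rfl

/-- The sites differ only in the first coordinate, and the truncation width `R cos α` is half their
spacing. -/
lemma truncDisc_lineSite_subset {R α : ℝ} (hRc : 0 < R * cos α) (k : ℕ) :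
    truncDisc (lineSite R α k) R α ⊆ voronoiCell (lineSite R α) k := by
  rintro p ⟨-, hp⟩ j
  rw [dist_eq_norm, dist_eq_norm, norm_plane, norm_plane]
  simp only [PiLp.sub_apply, lineSite_zero, lineSite_one] at hp ⊢
  refine sqrt_le_sqrt (add_le_add_left ?_ _)
  rcases eq_or_ne j k with rfl | hjk
  · exact le_rfl
  refine sq_le_sq.2 (hp.trans (le_abs.2 ?_))
  obtain ⟨h1, h2⟩ := abs_le.1 hp
  rcases lt_or_gt_of_ne hjk with h | h
  · have h' : (j : ℝ) + 1 ≤ k := by exact_mod_cast h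
    exact Or.inl (by nlinarith [mul_le_mul_of_nonneg_left h' hRc.le])
  · have h' : (k : ℝ) + 1 ≤ j := by exact_mod_cast h
    exact Or.inr (by nlinarith [mul_le_mul_of_nonneg_left h' hRc.le])

lemma lineSite_injective {R α : ℝ} (hRc : 0 < R * cos α) : Function.Injective (lineSite R α) := by
  intro j k h
  have h0 := congrArg (fun p : Plane => p 0) h
  simp only [lineSite_zero] at h0
  have : 2 * R * cos α ≠ 0 := by nlinarith
  exact_mod_cast mul_left_cancel₀ this h0

lemma inboundLength_lineSite {R α : ℝ} (hRc : 0 < R * cos α) {i : ℕ} (hi : 1 ≤ i) :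
    inboundLength (lineSite R α) i = 2 * (R * cos α) := by
  obtain ⟨k, rfl⟩ := Nat.exists_eq_add_of_le' hi
  have h : ∀ n : ℕ, dist (lineSite R α n) (lineSite R α (n + 1)) = 2 * (R * cos α) := by
    intro n
    rw [dist_eq_norm, norm_plane]
    simp only [PiLp.sub_apply, lineSite_zero, lineSite_one, Nat.cast_add, Nat.cast_one]
    rw [show (2 * R * cos α * n - 2 * R * cos α * (n + 1)) ^ 2 + (0 - 0) ^ 2 =
      (2 * (R * cos α)) ^ 2 by ring, sqrt_sq (by linarith)]
  rw [inboundLength, add_tsub_cancel_right, dist_comm, h, h]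
  ring

lemma iUnion_truncDisc_lineSite_ne_univ (R α : ℝ) :
    (⋃ k, truncDisc (lineSite R α k) R α) ≠ univ := by
  intro h
  -- A point farther than `R` from the whole line of sites.
  have hm : (!₂[0, |R| + 1] : Plane) ∈ ⋃ k, truncDisc (lineSite R α k) R α := h ▸ mem_univ _
  obtain ⟨k, hk, -⟩ := mem_iUnion.1 hm
  have h1 := norm_plane_sq ((!₂[0, |R| + 1] : Plane) - lineSite R α k)
  simp only [PiLp.sub_apply, lineSite_one, sub_zero] at h1
  change _ = (0 - lineSite R α k 0) ^ 2 + (|R| + 1) ^ 2 at h1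
  nlinarith [norm_nonneg ((!₂[0, |R| + 1] : Plane) - lineSite R α k), le_abs_self R,
    abs_nonneg R, sq_nonneg (0 - lineSite R α k 0)]

lemma averageCost_truncDisc_lineSite {f κ r q : ℝ} (hκ : 0 < κ) (hr : 0 ≤ r)
    (hq : 0 < q) (hq3 : q ^ 3 = 2 * gInf r / κ) {N : ℕ} (hN : 1 ≤ N) {R : ℝ} (hR : 0 < R)
    (hRq : R * √(unitArea (alphaInf r)) = q) :
    averageCost f κ r N (lineSite R (alphaInf r))
      (fun k => truncDisc (lineSite R (alphaInf r) k) R (alphaInf r)) = 3 * f / q ^ 2 := by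
  have hm := (alphaInf_spec hr).1
  have hRc : 0 < R * cos (alphaInf r) := mul_pos hR (cos_pos_of_mem hm)
  have hN' : (0 : ℝ) < N := by exact_mod_cast hN
  have hRA : R ^ 2 * unitArea (alphaInf r) = q ^ 2 := by
    rw [← hRq, mul_pow, sq_sqrt (unitArea_pos hm).le]
  have hA : ∑ i ∈ Finset.Icc 1 N,
      area (truncDisc (lineSite R (alphaInf r) i) R (alphaInf r)) = N * q ^ 2 := by
    simp [area_truncDisc _ hR hm, hRA]
  have hO : ∑ i ∈ Finset.Icc 1 N, outbound (truncDisc (lineSite R (alphaInf r) i) R (alphaInf r))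
      (lineSite R (alphaInf r) i) =
      N * (R ^ 3 * unitArea (alphaInf r) - coneStrip R (R * cos (alphaInf r))) := by
    simp [outbound_truncDisc _ hR hm, mul_sub]
  have hl : ∑ i ∈ Finset.Icc 1 N, inboundLength (lineSite R (alphaInf r)) i =
      N * (2 * (R * cos (alphaInf r))) := by
    rw [Finset.sum_congr rfl fun i hi => inboundLength_lineSite hRc (Finset.mem_Icc.1 hi).1]
    simp
  have htr := travel_alphaInf hR hr
  rw [hRA, hRq, hq3] at htr
  rw [averageCost_eq hN _ _ hq hA, hO, hl]
  have hg := gInf_pos hr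
  have e : ∀ O L : ℝ, O + r * q ^ 2 * L = 2 * gInf r / κ / gInf r →
      f / q ^ 2 + κ * f / (N * q ^ 2) * (N * O + r * q ^ 2 * (N * L)) = 3 * f / q ^ 2 := by
    intro O L h
    rw [show (N : ℝ) * O + r * q ^ 2 * (N * L) = N * (O + r * q ^ 2 * L) by ring, h]
    field_simp
    ring
  exact e _ _ htr

end Transship

theorem mainTheorem5 (f κ r : ℝ) (hf : 0 < f) (hκ : 0 < κ) (hr : 0 ≤ r) :
    -- the quantities `α*(n, r)`, `α*(∞, r)` and `g(∞, r)` are well defined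
    (∀ n : ℕ, 3 ≤ n → ∃! α : ℝ, α ∈ Ico (π / n) (π / 2) ∧ Transship.angleH n r α = 0) ∧
    (∀ α ∈ Ico (0 : ℝ) (π / 2),
      Tendsto (fun n : ℕ => ((n : ℝ) - 2) * Transship.angleH n r α) atTop
        (𝓝 (Transship.angleHInf r α))) ∧
    (∃! α : ℝ, α ∈ Ico 0 (π / 2) ∧ Transship.angleHInf r α = 0) ∧
    Tendsto (fun n : ℕ => Transship.gFun n r) atTop (𝓝 (Transship.gInf r)) ∧
    0 < Transship.gInf r ∧
    -- the lower bound
    (Transship.costBound f κ r : EReal) ≤ Transship.optimalCost f κ r ∧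
    -- it is attained by the idealized straight-line arrangement
    ∃ R : ℝ, 0 < R ∧
      -- the area of each region is the optimal one
      (∀ k, Transship.area (Transship.idealRegion
          (Transship.lineSite R (Transship.alphaInf r) k) R (Transship.alphaInf r)) =
        (κ / 2) ^ (-(2 / 3) : ℝ) * Transship.gInf r ^ (2 / 3 : ℝ)) ∧
      -- the regions do not overlap, and each lies in the cell of its facility
      (∀ j k, j ≠ k → volume
        (Transship.idealRegion
            (Transship.lineSite R (Transship.alphaInf r) j) R (Transship.alphaInf r) ∩
          Transship.idealRegion
            (Transship.lineSite R (Transship.alphaInf r) k) R (Transship.alphaInf r)) = 0) ∧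
      (∀ k, Transship.idealRegion
          (Transship.lineSite R (Transship.alphaInf r) k) R (Transship.alphaInf r) ⊆
        Transship.voronoiCell (Transship.lineSite R (Transship.alphaInf r)) k) ∧
      -- the cost is equal to the bound
      (∀ N : ℕ, 1 ≤ N →
        Transship.averageCost f κ r N (Transship.lineSite R (Transship.alphaInf r))
          (fun k => Transship.idealRegion
            (Transship.lineSite R (Transship.alphaInf r) k) R (Transship.alphaInf r)) =
        Transship.costBound f κ r) ∧
      -- the arrangement is infeasible: it does not cover the plane, and no feasible layout has
      -- a service region of this shape
      (⋃ k, Transship.idealRegion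
          (Transship.lineSite R (Transship.alphaInf r) k) R (Transship.alphaInf r)) ≠ univ ∧
      (∀ x : ℕ → Transship.Plane, Transship.IsFeasibleLayout x →
        ∀ (i k : ℕ) (φ : Transship.Plane ≃ᵢ Transship.Plane),
          Transship.voronoiCell x i ≠ φ '' Transship.idealRegion
            (Transship.lineSite R (Transship.alphaInf r) k) R (Transship.alphaInf r)) := by
  have hm := (Transship.alphaInf_spec hr).1
  have hg := Transship.gInf_pos hr
  have hU := Transship.unitArea_pos hm
  refine ⟨fun n hn => Transship.existsUnique_angleH_root hn hr, fun α hα => ?_,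
    Transship.existsUnique_angleHInf_root hr, ?_, hg,
    Transship.costBound_le_optimalCost hf hκ hr, ?_⟩
  · rw [Transship.angleHInf_eq hα]
    exact Transship.tendsto_angleH hα
  · rw [Transship.gInf_eq hr]
    exact Transship.tendsto_gFun hr
  have hq0 : 0 < 2 * Transship.gInf r / κ := by positivity
  -- The minimiser of `f / u² + κ f u / g(∞, r)`, so `q²` is the optimal area.
  set q := (2 * Transship.gInf r / κ) ^ (1 / 3 : ℝ) with hqdef
  have hq : 0 < q := rpow_pos_of_pos hq0 _
  have hq3 : q ^ 3 = 2 * Transship.gInf r / κ := by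
    rw [hqdef, ← rpow_natCast, ← rpow_mul hq0.le]; norm_num
  have hq2 : q ^ 2 = (κ / 2) ^ (-(2 / 3) : ℝ) * Transship.gInf r ^ (2 / 3 : ℝ) := by
    rw [hqdef, ← rpow_natCast, ← rpow_mul hq0.le, rpow_neg (by positivity),
      ← inv_rpow (by positivity), ← mul_rpow (by positivity) hg.le]
    congr 1
    · field_simp
    · norm_num
  have hs : 0 < √(Transship.unitArea (Transship.alphaInf r)) := sqrt_pos.2 hU
  have hR : 0 < q / √(Transship.unitArea (Transship.alphaInf r)) := by positivity
  refine ⟨_, hR, ?_⟩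
  have hRq := div_mul_cancel₀ q hs.ne'
  set R := q / √(Transship.unitArea (Transship.alphaInf r))
  have hRc : 0 < R * cos (Transship.alphaInf r) := mul_pos hR (Transship.cos_pos_of_mem hm)
  simp only [Transship.idealRegion_eq _ hR hm]
  refine ⟨fun k => ?_, fun j k hjk => ?_, Transship.truncDisc_lineSite_subset hRc,
    fun N hN => ?_, Transship.iUnion_truncDisc_lineSite_ne_univ _ _, fun x hx i k φ =>
      Transship.voronoiCell_ne_image_truncDisc hx i φ _ hR hm⟩
  · rw [Transship.area_truncDisc _ hR hm, ← hq2, ← hRq, mul_pow, sq_sqrt hU.le]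
  · refine measure_mono_null ((inter_subset_inter (Transship.truncDisc_lineSite_subset hRc j)
      (Transship.truncDisc_lineSite_subset hRc k)).trans
        (Transship.voronoiCell_inter_subset _ _ _)) (Transship.volume_bisector fun h => hjk ?_)
    exact Transship.lineSite_injective hRc h
  · rw [Transship.costBound_eq hf hκ hr hq hq3]
    exact Transship.averageCost_truncDisc_lineSite hκ hr hq hq3 hN hR hRq
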